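/- All graphs are finite and simple. For a graph $G$ of order $n \ge 2$, let $L(G) = D(G) - A(G)$ be its Laplacian matrix, where $D(G)$ is the diagonal matrix of vertex degrees and $A(G)$ the adjacency matrix, and let $\lambda_1(G) \ge \lambda_2(G) \ge \dots \ge \lambda_{n-1}(G) \ge \lambda_n(G) = 0$ be the eigenvalues of $L(G)$, counted with multiplicity. The algebraic connectivity of $G$ is $\alpha(G) = \lambda_{n-1}(G)$. The clique number of $G$ is the largest number of vertices in a complete subgraph of $G$. For $1 \le r \le n$, the kite graph $Ki_{n,r}$ is the graph of order $n$ obtained from the complete graph $K_r$ by attaching a pendant path of length $n-r$ at one vertex of $K_r$. **Theorem.** Let $G$ be a connected graph of order $n$ with clique number $r \ge 2$. Then $$\alpha(G) \ge \alpha(Ki_{n,r}),$$ and equality holds if and only if $G$ is isomorphic to $Ki_{n,r}$. -/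

import Mathlib

open Classical in
/-- The algebraic connectivity `α(G)` of a finite simple graph of order `n ≥ 2`: if
`λ₁ ≥ λ₂ ≥ ⋯ ≥ λₙ` are the eigenvalues, with multiplicity, of the Laplacian matrix
`L(G) = D(G) - A(G)`, it is `λₙ₋₁`. The decreasing list `eigenvalues₀` is indexed from `0`,
so that `λₙ₋₁` has index `n - 2`. A graph with fewer than two vertices gets the value `0`. -/
noncomputable def SimpleGraph.algebraicConnectivity {V : Type*} [Fintype V]
    (G : SimpleGraph V) : ℝ :=
  if h : 2 ≤ Fintype.card V then
    (G.isHermitian_lapMatrix ℝ).eigenvalues₀ ⟨Fintype.card V - 2, by omega⟩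
  else 0

/-- The kite graph `Ki_{n,r}`, for `1 ≤ r ≤ n`: the vertices `0, …, r - 1` form a clique `K_r`, and
a pendant path `r - 1, r, …, n - 1` of length `n - r` is attached to its vertex `r - 1`. -/
def kiteGraph (n r : ℕ) : SimpleGraph (Fin n) where
  Adj i j := i ≠ j ∧
    (((i : ℕ) < r ∧ (j : ℕ) < r) ∨ (i : ℕ) + 1 = (j : ℕ) ∨ (j : ℕ) + 1 = (i : ℕ))
  symm := ⟨fun i j h => by
    obtain ⟨hne, h⟩ := h
    refine ⟨hne.symm, ?_⟩
    tauto⟩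
  loopless := ⟨fun _ h => h.1 rfl⟩

/-!
Suppose that the algebraic connectivity `α` of `G` is at most the value `μ` of the kite; it is
enough to show that `G` is the kite. Order the vertices so that a Fiedler vector `f` decreases, and
let `X k` be the sum of its `k` largest values.

Summing the eigenvalue equation over the first `k` vertices shows that `α * X k` is the total
difference of `f` along the edges leaving this set (`partialSum_laplacian`). Connectedness gives
`f (k - 1) - f k ≤ α * X k`, a second order difference inequality for `X`, with equality along a
path. By a discrete Wronskian, the ratio of consecutive terms of `X`, read from either end, is
controlled by the sequence `pathSeq μ` that solves the equation on a path (`mul_pathSeq_le`).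

The clique enters through two cuts only. Just after its first vertex `p` and just before its last
vertex `q`, the edges of the clique yield `r * (f p - f q) ≤ α * (X (p + 1) + X q)`
(`IsClique.mul_sub_le`). The positions of the clique need not be consecutive, but as `X` is concave
the inequality passes to a window of `r` consecutive positions between them. With `a` vertices
before the window and `b` after it, `a + b = n - r` is the length of the path of the kite, and the
addition formulas for `pathSeq` turn the eigenvalue equation of the kite into an exact identity
between the path ratios at `a` and `b` (`IsKiteValue.split_identity`). For `r ≥ 3` the identity
shows that the window inequality can only hold when `a = 0` or `b = 0`, with `α = μ` and equality in
all the estimates (`rigidity_of_window`). For `r = 2` the window inequality at `a = 0` is the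
inequality for the first gap, so the same argument applies. Equality forces each cut beyond the
clique to be crossed by a single edge between consecutive vertices, which makes `G` the kite.

For the kite itself the same sequence describes the eigenvector: it has a decreasing Fiedler
vector, constant on the clique apart from the vertex carrying the path
(`kiteGraph_isKiteValue`).
-/

/-! ### The Laplacian and the algebraic connectivity -/

namespace SimpleGraph

section Spectral

variable {V : Type*} [Fintype V]

open Classical in
/-- The Laplacian of `G` as an operator on functions: `(L f)(u) = ∑_{v ∼ u} (f u - f v)`. -/
noncomputable def laplacian (G : SimpleGraph V) (f : V → ℝ) (u : V) : ℝ :=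
  ∑ v, if G.Adj u v then f u - f v else 0

open Classical in
theorem lapMatrix_mulVec_eq_laplacian (G : SimpleGraph V) (f : V → ℝ) :
    (G.lapMatrix ℝ).mulVec f = G.laplacian f := by
  ext u
  rw [lapMatrix_mulVec_apply, degree_eq_sum_if_adj, laplacian, Finset.sum_mul,
    neighborFinset_eq_filter, Finset.sum_filter, ← Finset.sum_sub_distrib]
  refine Finset.sum_congr rfl fun v _ => ?_
  split_ifs <;> simp

theorem sum_mul_laplacian_comm (G : SimpleGraph V) (f g : V → ℝ) :
    ∑ u, f u * G.laplacian g u = ∑ u, G.laplacian f u * g u := by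
  classical
  rw [← lapMatrix_mulVec_eq_laplacian, ← lapMatrix_mulVec_eq_laplacian]
  change f ⬝ᵥ _ = _ ⬝ᵥ g
  rw [Matrix.dotProduct_mulVec, ← Matrix.mulVec_transpose, (G.isSymm_lapMatrix ℝ).eq]

open Classical in
/-- The Dirichlet form of `G`, as a sum over ordered pairs. -/
theorem sum_mul_laplacian_self (G : SimpleGraph V) (f : V → ℝ) :
    ∑ u, f u * G.laplacian f u
      = (∑ u, ∑ v, if G.Adj u v then (f u - f v) ^ 2 else 0) / 2 := by
  rw [← G.lapMatrix_toLinearMap₂' (R := ℝ) f, Matrix.toLinearMap₂'_apply',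
    lapMatrix_mulVec_eq_laplacian]
  rfl

theorem laplacian_const (G : SimpleGraph V) (c : ℝ) (u : V) :
    G.laplacian (fun _ => c) u = 0 := by
  simp [laplacian]

theorem sum_laplacian (G : SimpleGraph V) (f : V → ℝ) : ∑ u, G.laplacian f u = 0 := by
  have h := G.sum_mul_laplacian_comm (fun _ => 1) f
  simpa [laplacian_const] using h

theorem laplacian_add_smul (G : SimpleGraph V) (f g : V → ℝ) (t : ℝ) (u : V) :
    G.laplacian (fun v => f v + t * g v) u = G.laplacian f u + t * G.laplacian g u := by
  simp only [laplacian, Finset.mul_sum, ← Finset.sum_add_distrib]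
  refine Finset.sum_congr rfl fun v _ => ?_
  split_ifs <;> ring

open Classical in
/-- For a connected graph there is an orthonormal basis of eigenvectors in which one vector spans
the constants, with eigenvalue `0`, and every other eigenvalue is at least the algebraic
connectivity, which is attained. -/
theorem exists_eigenbasis (G : SimpleGraph V) (hG : G.Connected) (hV : 2 ≤ Fintype.card V) :
    ∃ (b : OrthonormalBasis V ℝ (EuclideanSpace ℝ V)) (ev : V → ℝ) (p q : V), p ≠ q ∧
      (∀ j, G.laplacian (b j) = fun u => ev j * b j u) ∧
      (∀ j, j ≠ p → ∑ u, b j u = 0) ∧ (∃ c, ∀ u, b p u = c) ∧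
      (∀ j, j ≠ p → ev q ≤ ev j) ∧ ev q = G.algebraicConnectivity := by
  set hA := G.isHermitian_lapMatrix ℝ with hAdef
  set E : Fin (Fintype.card V) ≃ V := Fintype.equivOfCardEq (Fintype.card_fin _) with hE
  set b := hA.eigenvectorBasis with hb
  have hev : ∀ j, hA.eigenvalues j = hA.eigenvalues₀ (E.symm j) := fun j => rfl
  have hL : ∀ j, G.laplacian (b j) = fun u => hA.eigenvalues j * b j u := by
    intro j
    rw [← lapMatrix_mulVec_eq_laplacian, hA.mulVec_eigenvectorBasis]
    rfl
  have hnn : ∀ j, 0 ≤ hA.eigenvalues j := fun j => (G.posSemidef_lapMatrix ℝ).eigenvalues_nonneg j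
  set p := E ⟨Fintype.card V - 1, by omega⟩ with hp
  set q := E ⟨Fintype.card V - 2, by omega⟩ with hq
  have hpq : p ≠ q := by
    intro h
    have := congrArg Fin.val (E.injective h)
    simp only at this
    omega
  have hmin : ∀ j, hA.eigenvalues p ≤ hA.eigenvalues j := by
    intro j
    rw [hev, hev]
    apply hA.eigenvalues₀_antitone
    rw [Fin.le_def]
    simp only [hp, Equiv.symm_apply_apply]
    have := (E.symm j).2
    omega
  have hq' : ∀ j, j ≠ p → hA.eigenvalues q ≤ hA.eigenvalues j := by
    intro j hj
    rw [hev, hev]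
    apply hA.eigenvalues₀_antitone
    rw [Fin.le_def]
    simp only [hq, Equiv.symm_apply_apply]
    have h1 := (E.symm j).2
    have h2 : ((E.symm j : Fin _) : ℕ) ≠ Fintype.card V - 1 := by
      intro h
      apply hj
      rw [hp, ← E.apply_symm_apply j]
      congr 1
      exact Fin.ext h
    omega
  -- the smallest eigenvalue is `0`: otherwise the constants would be orthogonal to the basis
  have hp0 : hA.eigenvalues p = 0 := by
    by_contra hne
    have hpos : ∀ j, hA.eigenvalues j ≠ 0 := fun j =>
      (lt_of_lt_of_le (lt_of_le_of_ne (hnn p) (Ne.symm hne)) (hmin j)).ne'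
    have hz : ∀ j, inner ℝ (b j) (WithLp.toLp 2 (fun _ : V => (1 : ℝ))) = 0 := by
      intro j
      have h := G.sum_laplacian (b j)
      rw [hL] at h
      simp only [← Finset.mul_sum] at h
      have h' := (mul_eq_zero.mp h).resolve_left (hpos j)
      simpa [PiLp.inner_apply] using h'
    have h1 : (WithLp.toLp 2 (fun _ : V => (1 : ℝ))) = 0 := by
      rw [← b.sum_repr' (WithLp.toLp 2 (fun _ : V => (1 : ℝ)))]
      simp [hz]
    have := congrArg (fun v : EuclideanSpace ℝ V => v p) h1
    simp at this
  have hconst : ∃ c, ∀ u, b p u = c := by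
    refine ⟨b p p, fun u => ?_⟩
    have h0 : (G.lapMatrix ℝ).mulVec (b p) = 0 := by
      rw [lapMatrix_mulVec_eq_laplacian, hL, hp0]
      ext u
      simp
    exact (G.lapMatrix_mulVec_eq_zero_iff_forall_reachable.mp h0) u p (hG.preconnected u p)
  refine ⟨b, hA.eigenvalues, p, q, hpq, hL, ?_, hconst, hq', ?_⟩
  · intro j hj
    obtain ⟨c, hc⟩ := hconst
    have h1 : inner ℝ (b p) (b j) = 0 := b.orthonormal.2 (Ne.symm hj)
    have h2 : inner ℝ (b p) (b p) = (1 : ℝ) := by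
      rw [real_inner_self_eq_norm_sq, b.orthonormal.1 p]; norm_num
    have h3 : c ≠ 0 := by
      rintro rfl
      rw [PiLp.inner_apply] at h2
      simp [hc] at h2
    simp only [PiLp.inner_apply, hc, RCLike.inner_apply, conj_trivial, ← Finset.sum_mul] at h1
    exact (mul_eq_zero.mp h1).resolve_right h3
  · rw [hev, hq, Equiv.symm_apply_apply, algebraicConnectivity, dif_pos hV]

/-- A Fiedler vector: a nonzero eigenvector orthogonal to the constants for the algebraic
connectivity. -/
theorem exists_fiedler (G : SimpleGraph V) (hG : G.Connected) (hV : 2 ≤ Fintype.card V) :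
    ∃ f : V → ℝ, f ≠ 0 ∧ ∑ u, f u = 0 ∧
      ∀ u, G.laplacian f u = G.algebraicConnectivity * f u := by
  obtain ⟨b, ev, p, q, hpq, hL, hs, -, -, hq⟩ := G.exists_eigenbasis hG hV
  refine ⟨b q, fun h => ?_, hs q hpq.symm, fun u => by rw [hL, hq]⟩
  have h2 : ‖b q‖ = 1 := b.orthonormal.1 q
  have : b q = 0 := by
    ext u
    exact congrFun h u
  simp [this] at h2

/-- The variational lower bound for the Dirichlet form on functions of mean zero. -/
theorem algebraicConnectivity_mul_le (G : SimpleGraph V) (hG : G.Connected)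
    (hV : 2 ≤ Fintype.card V) (f : V → ℝ) (hf : ∑ u, f u = 0) :
    G.algebraicConnectivity * ∑ u, f u ^ 2 ≤ ∑ u, f u * G.laplacian f u := by
  obtain ⟨b, ev, p, q, hpq, hL, hs, ⟨c, hc⟩, hle, hq⟩ := G.exists_eigenbasis hG hV
  have key : ∀ g h : V → ℝ,
      ∑ u, g u * h u = ∑ j, (∑ u, g u * b j u) * (∑ u, b j u * h u) := by
    intro g h
    have := b.sum_inner_mul_inner (WithLp.toLp 2 g) (WithLp.toLp 2 h)
    simp only [PiLp.inner_apply, RCLike.inner_apply, conj_trivial] at this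
    rw [Finset.sum_congr rfl fun u _ => mul_comm (g u) (h u), ← this]
    exact Finset.sum_congr rfl fun j _ => by
      congr 1 <;> exact Finset.sum_congr rfl fun u _ => mul_comm _ _
  have h1 : ∀ j, ∑ u, b j u * G.laplacian f u = ev j * ∑ u, f u * b j u := by
    intro j
    rw [sum_mul_laplacian_comm, hL, Finset.mul_sum]
    exact Finset.sum_congr rfl fun u _ => by ring
  simp only [pow_two]
  rw [key f f, key f (G.laplacian f), Finset.mul_sum]
  refine Finset.sum_le_sum fun j _ => ?_
  rw [h1]
  have h2 : ∑ u, b j u * f u = ∑ u, f u * b j u :=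
    Finset.sum_congr rfl fun u _ => mul_comm _ _
  rw [h2]
  by_cases hj : j = p
  · have : ∑ u, f u * b j u = 0 := by
      simp only [hj, hc, ← Finset.sum_mul, hf, zero_mul]
    simp [this]
  · have := hle j hj
    rw [hq] at this
    nlinarith [mul_self_nonneg (∑ u, f u * b j u)]

/-- A function of mean zero attaining the variational bound is an eigenvector. -/
theorem laplacian_eq_of_le (G : SimpleGraph V) (hG : G.Connected)
    (hV : 2 ≤ Fintype.card V) (f : V → ℝ) (hf : ∑ u, f u = 0)
    (hle : ∑ u, f u * G.laplacian f u ≤ G.algebraicConnectivity * ∑ u, f u ^ 2) (u : V) :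
    G.laplacian f u = G.algebraicConnectivity * f u := by
  set α := G.algebraicConnectivity with hα
  -- perturb `f` in the direction of the residual `g`; the first variation is `2 ∑ g ^ 2`
  set g : V → ℝ := fun u => G.laplacian f u - α * f u with hg
  have hg0 : ∑ u, g u = 0 := by
    simp only [hg, Finset.sum_sub_distrib, sum_laplacian, ← Finset.mul_sum, hf]
    simp
  set N := ∑ u, g u ^ 2 with hN
  set Q := ∑ u, g u * G.laplacian g u - α * ∑ u, g u ^ 2 with hQ
  have hpert : ∀ t : ℝ, 0 ≤ 2 * t * N + t ^ 2 * Q := by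
    intro t
    have h1 := G.algebraicConnectivity_mul_le hG hV (fun u => f u + t * g u) (by
      simp [Finset.sum_add_distrib, ← Finset.mul_sum, hf, hg0])
    have h2 : ∑ u, f u * G.laplacian g u = ∑ u, g u * G.laplacian f u := by
      rw [sum_mul_laplacian_comm]
      exact Finset.sum_congr rfl fun u _ => mul_comm _ _
    have h3 : ∑ u, (f u + t * g u) * G.laplacian (fun v => f v + t * g v) u
        = ∑ u, f u * G.laplacian f u + t * (∑ u, f u * G.laplacian g u)
          + t * (∑ u, g u * G.laplacian f u) + t ^ 2 * ∑ u, g u * G.laplacian g u := by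
      simp only [Finset.mul_sum, ← Finset.sum_add_distrib, laplacian_add_smul]
      exact Finset.sum_congr rfl fun u _ => by ring
    have h4 : ∑ u, (f u + t * g u) ^ 2
        = ∑ u, f u ^ 2 + 2 * t * (∑ u, f u * g u) + t ^ 2 * ∑ u, g u ^ 2 := by
      simp only [Finset.mul_sum, ← Finset.sum_add_distrib]
      exact Finset.sum_congr rfl fun u _ => by ring
    have h5 : N = ∑ u, g u * G.laplacian f u - α * ∑ u, f u * g u := by
      rw [hN, Finset.mul_sum, ← Finset.sum_sub_distrib]
      exact Finset.sum_congr rfl fun u _ => by simp only [hg]; ring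
    rw [h3, h4, h2] at h1
    rw [h5, hQ]
    nlinarith
  have hN0 : 0 ≤ N := Finset.sum_nonneg fun u _ => sq_nonneg _
  have hNz : N = 0 := by
    by_contra hne
    have hpos : 0 < N := lt_of_le_of_ne hN0 (Ne.symm hne)
    have h := hpert (-N / (|Q| + 1))
    have hd : 0 < |Q| + 1 := by positivity
    have h' : 2 * (-N / (|Q| + 1)) * N + (-N / (|Q| + 1)) ^ 2 * Q
        = N ^ 2 / (|Q| + 1) ^ 2 * (Q - 2 * (|Q| + 1)) := by
      field_simp
      ring
    rw [h'] at h
    have h6 : Q - 2 * (|Q| + 1) < 0 := by linarith [le_abs_self Q, abs_nonneg Q]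
    have h7 : 0 < N ^ 2 / (|Q| + 1) ^ 2 := by positivity
    nlinarith
  have := (Finset.sum_eq_zero_iff_of_nonneg fun u _ => sq_nonneg (g u)).mp hNz u
    (Finset.mem_univ u)
  have h8 : g u = 0 := by simpa using this
  simp only [hg] at h8
  linarith

theorem laplacian_comp_iso {W : Type*} [Fintype W] {G : SimpleGraph V} {H : SimpleGraph W}
    (φ : G ≃g H) (f : W → ℝ) (u : V) :
    G.laplacian (fun v => f (φ v)) u = H.laplacian f (φ u) := by
  rw [laplacian, laplacian, ← Equiv.sum_comp φ.toEquiv]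
  refine Finset.sum_congr rfl fun v _ => ?_
  have h : H.Adj (φ u) (φ.toEquiv v) ↔ G.Adj u v := φ.map_adj_iff
  by_cases hv : G.Adj u v
  · rw [if_pos hv, if_pos (h.mpr hv)]
    rfl
  · rw [if_neg hv, if_neg fun h' => hv (h.mp h')]

theorem algebraicConnectivity_le_of_iso {W : Type*} [Fintype W] {G : SimpleGraph V}
    {H : SimpleGraph W} (φ : G ≃g H) (hG : G.Connected) (hV : 2 ≤ Fintype.card V) :
    G.algebraicConnectivity ≤ H.algebraicConnectivity := by
  have hH : H.Connected := φ.connected_iff.mp hG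
  have hW : 2 ≤ Fintype.card W := by rwa [← Fintype.card_congr φ.toEquiv]
  obtain ⟨f, hf, hs, he⟩ := H.exists_fiedler hH hW
  have hsum : ∀ k : W → ℝ, ∑ v, k (φ v) = ∑ w, k w := fun k => Equiv.sum_comp φ.toEquiv k
  have h := G.algebraicConnectivity_mul_le hG hV (fun v => f (φ v)) (by rw [hsum, hs])
  simp only [laplacian_comp_iso, he] at h
  rw [hsum (fun w => f w ^ 2), hsum (fun w => f w * (H.algebraicConnectivity * f w))] at h
  have h2 : ∑ w, f w * (H.algebraicConnectivity * f w)
      = H.algebraicConnectivity * ∑ w, f w ^ 2 := by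
    rw [Finset.mul_sum]
    exact Finset.sum_congr rfl fun w _ => by ring
  rw [h2] at h
  obtain ⟨w, hw⟩ := Function.ne_iff.mp hf
  have h3 : 0 < ∑ w, f w ^ 2 :=
    Finset.sum_pos' (fun w _ => sq_nonneg _) ⟨w, Finset.mem_univ w, by
      have : f w ≠ 0 := hw
      positivity⟩
  exact le_of_mul_le_mul_right h h3

theorem algebraicConnectivity_congr {W : Type*} [Fintype W] {G : SimpleGraph V}
    {H : SimpleGraph W} (φ : G ≃g H) (hG : G.Connected) (hV : 2 ≤ Fintype.card V) :
    G.algebraicConnectivity = H.algebraicConnectivity :=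
  le_antisymm (algebraicConnectivity_le_of_iso φ hG hV)
    (algebraicConnectivity_le_of_iso φ.symm (φ.connected_iff.mp hG)
      (by rwa [← Fintype.card_congr φ.toEquiv]))

end Spectral

end SimpleGraph

/-! ### Sequences on a path and their comparison -/

/-- The solution of the Laplace eigenvalue equation `L h = μ h` along a path, started at a free
end with the value `1` and recorded through its partial sums: `pathSeq μ k` is the sum of the first
`k` values, and the equation reads `P (k + 2) - 2 P (k + 1) + P k = -μ P (k + 1)`. -/
def pathSeq (μ : ℝ) : ℕ → ℝ
  | 0 => 0
  | 1 => 1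
  | k + 2 => (2 - μ) * pathSeq μ (k + 1) - pathSeq μ k

theorem pathSeq_add_two (μ : ℝ) (k : ℕ) :
    pathSeq μ (k + 2) = (2 - μ) * pathSeq μ (k + 1) - pathSeq μ k := rfl

theorem pathSeq_add_succ (μ : ℝ) (a b : ℕ) :
    pathSeq μ (a + b + 1)
      = pathSeq μ (a + 1) * pathSeq μ (b + 1) - pathSeq μ a * pathSeq μ b := by
  induction b using Nat.twoStepInduction with
  | zero => simp [pathSeq]
  | one => simp [pathSeq]; ring
  | more b ih0 ih1 =>
    rw [show a + (b + 2) + 1 = (a + b + 1) + 2 by ring, pathSeq_add_two,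
      show a + b + 1 + 1 = a + (b + 1) + 1 by ring, ih0, ih1,
      show b + 2 + 1 = (b + 1) + 2 by ring, pathSeq_add_two μ (b + 1), pathSeq_add_two μ b]
    ring

theorem pathSeq_add (μ : ℝ) (a b : ℕ) :
    pathSeq μ (a + b) = pathSeq μ (a + 1) * pathSeq μ b + pathSeq μ a * pathSeq μ (b + 1)
      - (2 - μ) * (pathSeq μ a * pathSeq μ b) := by
  cases b with
  | zero => simp [pathSeq]
  | succ b =>
    rw [← add_assoc, pathSeq_add_succ, pathSeq_add_two]
    ring

theorem eq_mul_pathSeq {μ : ℝ} {Y : ℕ → ℝ} {M : ℕ} (h0 : Y 0 = 0)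
    (h : ∀ i < M, Y (i + 2) = (2 - μ) * Y (i + 1) - Y i) :
    ∀ i ≤ M + 1, Y i = Y 1 * pathSeq μ i := by
  intro i
  induction i using Nat.twoStepInduction with
  | zero => intro _; simp [pathSeq, h0]
  | one => intro _; simp [pathSeq]
  | more i ih0 ih1 =>
    intro hi
    rw [h i (by omega), ih0 (by omega), ih1 (by omega), pathSeq_add_two]
    ring

/-- The discrete Wronskian (Picone) identity for a sequence against `pathSeq`. -/
theorem wronskian_eq_sum (μ : ℝ) (X : ℕ → ℝ) (h0 : X 0 = 0) (M : ℕ) :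
    X (M + 1) * pathSeq μ M - X M * pathSeq μ (M + 1)
      = ∑ i ∈ Finset.range M, pathSeq μ (i + 1) * (X (i + 2) + X i - (2 - μ) * X (i + 1)) := by
  induction M with
  | zero => simp [pathSeq, h0]
  | succ M ih =>
    rw [Finset.sum_range_succ, ← ih, pathSeq_add_two]
    ring

section Comparison

variable {μ : ℝ} {X : ℕ → ℝ} {M : ℕ}

theorem mul_pathSeq_le (h0 : X 0 = 0) (hP : ∀ i, 1 ≤ i → i ≤ M → 0 < pathSeq μ i)
    (hX : ∀ i < M, (2 - μ) * X (i + 1) ≤ X (i + 2) + X i) :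
    X M * pathSeq μ (M + 1) ≤ X (M + 1) * pathSeq μ M := by
  rw [← sub_nonneg, wronskian_eq_sum μ X h0]
  refine Finset.sum_nonneg fun i hi => ?_
  rw [Finset.mem_range] at hi
  exact mul_nonneg (hP _ (by omega) (by omega)).le (sub_nonneg.mpr (hX i hi))

theorem eq_of_mul_pathSeq_eq (h0 : X 0 = 0) (hP : ∀ i, 1 ≤ i → i ≤ M → 0 < pathSeq μ i)
    (hX : ∀ i < M, (2 - μ) * X (i + 1) ≤ X (i + 2) + X i)
    (heq : X M * pathSeq μ (M + 1) = X (M + 1) * pathSeq μ M) {i : ℕ} (hi : i < M) :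
    X (i + 2) + X i = (2 - μ) * X (i + 1) := by
  have h := wronskian_eq_sum μ X h0 M
  rw [← heq, sub_self] at h
  have h2 := (Finset.sum_eq_zero_iff_of_nonneg (fun j hj => by
    rw [Finset.mem_range] at hj
    exact mul_nonneg (hP _ (by omega) (by omega)).le (sub_nonneg.mpr (hX j hj)))).mp h.symm i
    (Finset.mem_range.mpr hi)
  have h3 := (mul_eq_zero.mp h2).resolve_left (hP _ (by omega) (by omega)).ne'
  linarith

end Comparison

/-! ### The kite value and the two sides of the clique -/

/-- The conditions tying `μ` to the kite made of a clique on `c + 2` vertices and a pendant path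
of length `l`: the partial sums of the eigenvector, read from the end of the path, are
positive up to the clique and satisfy the eigenvalue equation on the clique. -/
structure IsKiteValue (c l : ℕ) (μ : ℝ) : Prop where
  pos : 0 < μ
  lt : μ < c + 2
  pathSeq_pos : ∀ i, 1 ≤ i → i ≤ l + 1 → 0 < pathSeq μ i
  clique : (c + 1) * pathSeq μ l = (c + 2 - μ) * pathSeq μ (l + 1)

namespace IsKiteValue

variable {c l : ℕ} {μ : ℝ}

/-- Splitting the pendant path into pieces of `a` and `b` vertices on either side of the clique
turns the eigenvalue equation of the kite into a relation between the two ratios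
`pathSeq μ a / pathSeq μ (a + 1)` and `pathSeq μ b / pathSeq μ (b + 1)`; it follows from the
addition formulas of `pathSeq`. -/
theorem split_identity (h : IsKiteValue c l μ) {a b : ℕ} (hab : a + b = l) {s t : ℝ}
    (hs : pathSeq μ a = s * pathSeq μ (a + 1)) (ht : pathSeq μ b = t * pathSeq μ (b + 1)) :
    (1 - t - μ / (c + 2)) * (1 + c * (1 - s)) + (1 - s - μ / (c + 2))
      = μ / (c + 2) * c * s * (1 + (c + 2) * t) := by
  have h1 := h.clique
  have hp := h.pathSeq_pos (a + 1) (by omega) (by omega)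
  have hq := h.pathSeq_pos (b + 1) (by omega) (by omega)
  rw [← hab, pathSeq_add, pathSeq_add_succ, hs, ht] at h1
  have h2 : ((c : ℝ) + 1) * (s + t - (2 - μ) * (s * t)) = (c + 2 - μ) * (1 - s * t) := by
    have hne : pathSeq μ (a + 1) * pathSeq μ (b + 1) ≠ 0 := (mul_pos hp hq).ne'
    apply mul_right_cancel₀ hne
    linear_combination h1
  have hc : (c : ℝ) + 2 ≠ 0 := by positivity
  field_simp
  linear_combination (-(c : ℝ) - 2) * h2

theorem ratio_mul_lt_one (h : IsKiteValue c l μ) {a b : ℕ} (hab : a + b = l) {s t : ℝ}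
    (hs : pathSeq μ a = s * pathSeq μ (a + 1)) (ht : pathSeq μ b = t * pathSeq μ (b + 1)) :
    s * t < 1 := by
  have h1 := h.pathSeq_pos (l + 1) (by omega) le_rfl
  have hp := h.pathSeq_pos (a + 1) (by omega) (by omega)
  have hq := h.pathSeq_pos (b + 1) (by omega) (by omega)
  rw [← hab, pathSeq_add_succ, hs, ht] at h1
  have := mul_pos hp hq
  by_contra hcon
  rw [not_lt] at hcon
  nlinarith [mul_le_mul_of_nonneg_right hcon this.le]

/-- On one of the two sides of the clique the path is short enough. -/
theorem exists_side (h : IsKiteValue c l μ) {a b : ℕ} (hab : a + b = l) :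
    pathSeq μ a ≤ (1 - μ / (c + 2)) * pathSeq μ (a + 1) ∨
      pathSeq μ b ≤ (1 - μ / (c + 2)) * pathSeq μ (b + 1) := by
  have hp := h.pathSeq_pos (a + 1) (by omega) (by omega)
  have hq := h.pathSeq_pos (b + 1) (by omega) (by omega)
  obtain ⟨s, hs⟩ : ∃ s, pathSeq μ a = s * pathSeq μ (a + 1) :=
    ⟨pathSeq μ a / pathSeq μ (a + 1), by field_simp⟩
  obtain ⟨t, ht⟩ : ∃ t, pathSeq μ b = t * pathSeq μ (b + 1) :=
    ⟨pathSeq μ b / pathSeq μ (b + 1), by field_simp⟩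
  have h1 := h.split_identity hab hs ht
  have h1' := h.split_identity (by omega : b + a = l) ht hs
  have h2 := h.ratio_mul_lt_one hab hs ht
  have hnn : ∀ i ≤ l, 0 ≤ pathSeq μ i := fun i hi => by
    rcases Nat.eq_zero_or_pos i with rfl | hi'
    · simp [pathSeq]
    · exact (h.pathSeq_pos i hi' (by omega)).le
  have hs0 : 0 ≤ s := nonneg_of_mul_nonneg_left (hs ▸ hnn a (by omega)) hp
  have ht0 : 0 ≤ t := nonneg_of_mul_nonneg_left (ht ▸ hnn b (by omega)) hq
  have hμ := h.pos
  have hc : (0 : ℝ) ≤ c := Nat.cast_nonneg c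
  have hκ : 0 < μ / (c + 2) := by positivity
  rw [hs, ht]
  by_contra hcon
  push Not at hcon
  obtain ⟨ha, hb⟩ := hcon
  have ha' := lt_of_mul_lt_mul_right ha hp.le
  have hb' := lt_of_mul_lt_mul_right hb hq.le
  have hR : 0 ≤ μ / (c + 2) * c * s * (1 + (c + 2) * t) := by positivity
  have hR' : 0 ≤ μ / (c + 2) * c * t * (1 + (c + 2) * s) := by positivity
  -- otherwise both `1 + c (1 - s)` and `1 + c (1 - t)` are negative, so `s, t > 1`
  have hs1 : 1 + c * (1 - s) < 0 := by
    by_contra hge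
    rw [not_lt] at hge
    nlinarith [mul_nonneg hge (by linarith : 0 ≤ t - (1 - μ / (c + 2)))]
  have ht1 : 1 + c * (1 - t) < 0 := by
    by_contra hge
    rw [not_lt] at hge
    nlinarith [mul_nonneg hge (by linarith : 0 ≤ s - (1 - μ / (c + 2)))]
  have hs2 : 1 < s := by
    by_contra hle
    nlinarith [mul_nonneg hc (by linarith : 0 ≤ 1 - s)]
  have ht2 : 1 < t := by
    by_contra hle
    nlinarith [mul_nonneg hc (by linarith : 0 ≤ 1 - t)]
  nlinarith

end IsKiteValue

/-- The inequality between the two sides of the clique. Here `A` and `B` are the total masses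
beyond the two ends, `x` and `y` the relative values at the ends, `p` and `q` lower bounds for
them. -/
theorem eq_of_two_sided_le {A B c x y p q κ : ℝ} (hA : 0 < A) (hB : 0 < B) (hc : 0 ≤ c)
    (hκ : 0 < κ) (hκ1 : κ < 1) (hx : p ≤ x) (hy : q ≤ y) (hp : κ ≤ p)
    (hBA : B ≤ A * (1 + c * x)) (hle : A * (x - κ) + B * (y - κ) ≤ 0)
    (hT : 0 ≤ (q - κ) * (1 + c * p) + (p - κ))
    (hT0 : (q - κ) * (1 + c * p) + (p - κ) = 0 → p = 1) :
    p = 1 ∧ x = p ∧ y = q ∧ B = A * (1 + c * x) ∧ A * (x - κ) + B * (y - κ) = 0 := by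
  have hcp : 0 ≤ c * p := mul_nonneg hc (hκ.le.trans hp)
  have hyκ : y < κ := by
    by_contra hge
    rw [not_lt] at hge
    have h1 : 0 ≤ A * (x - κ) := mul_nonneg hA.le (by linarith)
    have h2 : 0 ≤ B * (y - κ) := mul_nonneg hB.le (by linarith)
    have h3 : A * (x - κ) = 0 := by linarith
    have h4 := (mul_eq_zero.mp h3).resolve_left hA.ne'
    have h5 : p = κ := by linarith
    have h6 : B * (y - κ) = 0 := by linarith
    have h7 := (mul_eq_zero.mp h6).resolve_left hB.ne'
    have h8 : (q - κ) * (1 + c * p) ≤ 0 :=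
      mul_nonpos_of_nonpos_of_nonneg (by linarith) (by linarith)
    have := hT0 (by linarith)
    linarith
  have hqκ : q < κ := lt_of_le_of_lt hy hyκ
  have hpκ : 0 < p := hκ.trans_le hp
  have hfac : 0 < 1 + c * (q - κ) := by
    by_contra hneg
    rw [not_lt] at hneg
    nlinarith [mul_nonneg hpκ.le (by linarith : 0 ≤ -(1 + c * (q - κ)))]
  have hfac' : 0 < 1 + c * (y - κ) := by nlinarith
  -- the left side of `hle` is bounded below by `A` times the expression in `hT`
  have e1 : 0 ≤ (A * (1 + c * x) - B) * (κ - y) := mul_nonneg (by linarith) (by linarith)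
  have e2 : 0 ≤ (x - p) * (1 + c * (y - κ)) := mul_nonneg (by linarith) hfac'.le
  have e3 : 0 ≤ (1 + c * p) * (y - q) := mul_nonneg (by linarith) (by linarith)
  have key : A * (x - κ) + B * (y - κ) = (A * (1 + c * x) - B) * (κ - y)
      + A * ((x - p) * (1 + c * (y - κ)) + (1 + c * p) * (y - q)
        + ((q - κ) * (1 + c * p) + (p - κ))) := by ring
  have e4 : 0 ≤ A * ((x - p) * (1 + c * (y - κ)) + (1 + c * p) * (y - q)
        + ((q - κ) * (1 + c * p) + (p - κ))) := mul_nonneg hA.le (by linarith)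
  have z4 : A * ((x - p) * (1 + c * (y - κ)) + (1 + c * p) * (y - q)
        + ((q - κ) * (1 + c * p) + (p - κ))) = 0 := by linarith
  have z1 : (A * (1 + c * x) - B) * (κ - y) = 0 := by linarith
  have z5 := (mul_eq_zero.mp z4).resolve_left hA.ne'
  have z2 : (x - p) * (1 + c * (y - κ)) = 0 := by linarith
  have z3 : (1 + c * p) * (y - q) = 0 := by linarith
  refine ⟨hT0 (by linarith), ?_, ?_, ?_, by linarith⟩
  · linarith [(mul_eq_zero.mp z2).resolve_right hfac'.ne']
  · linarith [(mul_eq_zero.mp z3).resolve_left (show 0 < 1 + c * p by linarith).ne']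
  · linarith [(mul_eq_zero.mp z1).resolve_right (sub_pos.mpr hyκ).ne']

/-! ### Partial sums of decreasing sequences -/

section PartialSum

variable {n : ℕ}

/-- The sum of the first `k` values of a function on `Fin n`. -/
def partialSum (f : Fin n → ℝ) (k : ℕ) : ℝ := ∑ i : Fin n, if (i : ℕ) < k then f i else 0

theorem partialSum_zero (f : Fin n → ℝ) : partialSum f 0 = 0 := by simp [partialSum]

theorem partialSum_self (f : Fin n → ℝ) : partialSum f n = ∑ i, f i := by simp [partialSum]

theorem partialSum_sub (f : Fin n → ℝ) {a b : ℕ} (hab : a ≤ b) :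
    partialSum f b - partialSum f a = ∑ i : Fin n, if a ≤ (i : ℕ) ∧ (i : ℕ) < b then f i else 0 := by
  rw [partialSum, partialSum, ← Finset.sum_sub_distrib]
  refine Finset.sum_congr rfl fun i _ => ?_
  by_cases h1 : (i : ℕ) < a
  · rw [if_pos (by omega), if_pos h1, if_neg (by omega), sub_self]
  · by_cases h2 : (i : ℕ) < b
    · rw [if_pos h2, if_neg h1, if_pos (by omega), sub_zero]
    · rw [if_neg h2, if_neg h1, if_neg (by omega), sub_zero]

theorem partialSum_succ (f : Fin n → ℝ) {k : ℕ} (hk : k < n) :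
    partialSum f (k + 1) - partialSum f k = f ⟨k, hk⟩ := by
  rw [partialSum_sub f (Nat.le_succ k), Finset.sum_eq_single ⟨k, hk⟩]
  · rw [if_pos (by simp)]
  · intro i _ hi
    rw [if_neg]
    intro h
    exact hi (Fin.ext (by simp only; omega))
  · simp

theorem partialSum_const (x : ℝ) {k : ℕ} (hk : k ≤ n) :
    partialSum (fun _ : Fin n => x) k = k * x := by
  induction k with
  | zero => simp [partialSum_zero]
  | succ k ih =>
    have := partialSum_succ (fun _ : Fin n => x) (show k < n by omega)
    rw [ih (by omega)] at this
    push_cast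
    linarith

theorem partialSum_neg_rev (f : Fin n → ℝ) (hs : ∑ i, f i = 0) {k : ℕ} (hk : k ≤ n) :
    partialSum (fun i => -f i.rev) k = partialSum f (n - k) := by
  have h1 := partialSum_sub f (Nat.sub_le n k)
  rw [partialSum_self, hs] at h1
  have h2 : partialSum (fun i => -f i.rev) k
      = -∑ i : Fin n, if n - k ≤ (i : ℕ) ∧ (i : ℕ) < n then f i else 0 := by
    rw [partialSum, ← Equiv.sum_comp Fin.revPerm, ← Finset.sum_neg_distrib]
    refine Finset.sum_congr rfl fun i _ => ?_
    simp only [Fin.revPerm_apply, Fin.rev_rev, Fin.val_rev]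
    have := i.2
    by_cases h : n - k ≤ (i : ℕ)
    · rw [if_pos (by omega), if_pos ⟨h, this⟩]
    · rw [if_neg (by omega), if_neg (fun h' => h h'.1), neg_zero]
  rw [h2, ← h1]
  ring

section Antitone

variable {f : Fin n → ℝ}

theorem partialSum_pos (hf : Antitone f) (hne : f ≠ 0) (hs : ∑ i, f i = 0) {k : ℕ}
    (hk : 0 < k) (hkn : k < n) : 0 < partialSum f k := by
  by_contra hcon
  rw [not_lt] at hcon
  set p : Fin n := ⟨k - 1, by omega⟩ with hp
  set q : Fin n := ⟨k, hkn⟩ with hq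
  have hpq : f q ≤ f p := hf (by rw [Fin.le_def]; simp only [hp, hq]; omega)
  have hlow : ∀ i : Fin n, (i : ℕ) < k → f p ≤ f i := fun i hi =>
    hf (by rw [Fin.le_def]; simp only [hp]; omega)
  have hhigh : ∀ i : Fin n, k ≤ (i : ℕ) → f i ≤ f q := fun i hi =>
    hf (by rw [Fin.le_def]; simp only [hq]; omega)
  have htail := partialSum_sub f hkn.le
  rw [partialSum_self, hs] at htail
  have hp0 : f p ≤ 0 := by
    by_contra h
    rw [not_le] at h
    have : 0 < partialSum f k := by
      refine Finset.sum_pos' (fun i _ => ?_) ⟨p, Finset.mem_univ _, ?_⟩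
      · split_ifs with hi
        · linarith [hlow i hi]
        · exact le_rfl
      · rw [if_pos (by simp only [hp]; omega)]
        exact h
    linarith
  have hq0 : 0 ≤ f q := by
    by_contra h
    rw [not_le] at h
    have : (∑ i : Fin n, if k ≤ (i : ℕ) ∧ (i : ℕ) < n then f i else 0) < ∑ i : Fin n, (0 : ℝ) := by
      refine Finset.sum_lt_sum (fun i _ => ?_) ⟨q, Finset.mem_univ _, ?_⟩
      · split_ifs with hi
        · linarith [hhigh i hi.1]
        · exact le_rfl
      · rw [if_pos (by simp only [hq]; omega)]
        exact h
    rw [Finset.sum_const_zero] at this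
    linarith
  apply hne
  have hX : partialSum f k = 0 := by
    refine le_antisymm hcon (Finset.sum_nonneg fun i _ => ?_)
    split_ifs with hi
    · linarith [hlow i hi]
    · exact le_rfl
  ext i
  by_cases hi : (i : ℕ) < k
  · have := (Finset.sum_eq_zero_iff_of_nonneg (fun j _ => by
      split_ifs with hj
      · linarith [hlow j hj]
      · exact le_rfl)).mp hX i (Finset.mem_univ i)
    rwa [if_pos hi] at this
  · rw [hX, sub_zero] at htail
    have := (Finset.sum_eq_zero_iff_of_nonpos (fun j _ => by
      split_ifs with hj
      · linarith [hhigh j hj.1]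
      · exact le_rfl)).mp htail.symm i (Finset.mem_univ i)
    rwa [if_pos (by omega)] at this

/-- The partial sums of a decreasing sequence are concave, hence unimodal. -/
theorem min_le_partialSum (hf : Antitone f) {a b d : ℕ} (hab : a ≤ b) (hbd : b ≤ d) (hd : d ≤ n) :
    min (partialSum f a) (partialSum f d) ≤ partialSum f b := by
  rcases hab.eq_or_lt with rfl | hab'
  · exact min_le_left _ _
  by_cases h : 0 ≤ f ⟨b - 1, by omega⟩
  · refine (min_le_left _ _).trans (sub_nonneg.mp ?_)
    rw [partialSum_sub f hab]
    refine Finset.sum_nonneg fun i _ => ?_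
    split_ifs with hi
    · exact h.trans (hf (by rw [Fin.le_def]; simp only; omega))
    · exact le_rfl
  · refine (min_le_right _ _).trans (sub_nonpos.mp ?_)
    rw [partialSum_sub f hbd]
    refine Finset.sum_nonpos fun i _ => ?_
    split_ifs with hi
    · exact (hf (by rw [Fin.le_def]; simp only; omega)).trans (not_le.mp h).le
    · exact le_rfl

theorem partialSum_le_add_mul (hf : Antitone f) {a k m : ℕ} (hm : m = a + 1 + k) (hmn : m ≤ n) :
    partialSum f m ≤ partialSum f (a + 1) + k * f ⟨a, by omega⟩ := by
  induction k generalizing m with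
  | zero =>
    subst hm
    simp
  | succ k ih =>
    have h1 := ih rfl (show a + 1 + k ≤ n by omega)
    have h2 := partialSum_succ f (show a + 1 + k < n by omega)
    have h3 : f ⟨a + 1 + k, by omega⟩ ≤ f ⟨a, by omega⟩ :=
      hf (by rw [Fin.le_def]; simp only; omega)
    subst hm
    rw [show partialSum f (a + 1 + (k + 1)) = partialSum f (a + 1 + k + 1) from rfl]
    push_cast
    linarith

end Antitone

end PartialSum

/-! ### Cuts of an ordered vertex set -/

namespace SimpleGraph

section Cut

variable {n : ℕ} {G : SimpleGraph (Fin n)} {f : Fin n → ℝ} {α : ℝ}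

open Classical in
/-- The divergence theorem: the Laplacian summed over an initial segment is the flow across its
boundary, since the edges inside the segment cancel. -/
theorem partialSum_laplacian (G : SimpleGraph (Fin n)) (f : Fin n → ℝ) (k : ℕ) :
    partialSum (G.laplacian f) k
      = ∑ i : Fin n, ∑ j : Fin n,
          if (i : ℕ) < k ∧ k ≤ (j : ℕ) ∧ G.Adj i j then f i - f j else 0 := by
  have hin : ∑ i : Fin n, ∑ j : Fin n,
      (if (i : ℕ) < k ∧ (j : ℕ) < k ∧ G.Adj i j then f i - f j else 0) = 0 := by
    have h : ∑ i : Fin n, ∑ j : Fin n,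
        (if (i : ℕ) < k ∧ (j : ℕ) < k ∧ G.Adj i j then f i - f j else 0)
        = -∑ i : Fin n, ∑ j : Fin n,
        (if (i : ℕ) < k ∧ (j : ℕ) < k ∧ G.Adj i j then f i - f j else 0) := by
      conv_lhs => rw [Finset.sum_comm]
      simp only [← Finset.sum_neg_distrib]
      refine Finset.sum_congr rfl fun i _ => Finset.sum_congr rfl fun j _ => ?_
      by_cases h : (i : ℕ) < k ∧ (j : ℕ) < k ∧ G.Adj i j
      · rw [if_pos h, if_pos ⟨h.2.1, h.1, h.2.2.symm⟩, neg_sub]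
      · rw [if_neg h, if_neg (fun h' => h ⟨h'.2.1, h'.1, h'.2.2.symm⟩), neg_zero]
    linarith
  refine Eq.trans ?_ ((congrArg (_ + ·) hin).trans (add_zero _))
  rw [partialSum, ← Finset.sum_add_distrib]
  refine Finset.sum_congr rfl fun i _ => ?_
  rw [← Finset.sum_add_distrib]
  by_cases hi : (i : ℕ) < k
  · rw [if_pos hi, laplacian]
    refine Finset.sum_congr rfl fun j _ => ?_
    by_cases hj : (j : ℕ) < k
    · simp [hi, hj, not_le.mpr hj]
    · simp [hi, hj, not_lt.mp hj]
  · simp [hi]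

theorem partialSum_eigen (hL : ∀ u, G.laplacian f u = α * f u) (k : ℕ) :
    partialSum (G.laplacian f) k = α * partialSum f k := by
  simp only [partialSum, hL, Finset.mul_sum, mul_ite, mul_zero]

open Classical in
theorem sum_sub_le_mul_partialSum (hf : Antitone f) (hL : ∀ u, G.laplacian f u = α * f u)
    {k : ℕ} (S : Finset (Fin n × Fin n))
    (hS : ∀ e ∈ S, (e.1 : ℕ) < k ∧ k ≤ (e.2 : ℕ) ∧ G.Adj e.1 e.2) :
    ∑ e ∈ S, (f e.1 - f e.2) ≤ α * partialSum f k := by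
  rw [← partialSum_eigen hL, partialSum_laplacian, ← Fintype.sum_prod_type'
    (fun i j : Fin n => if (i : ℕ) < k ∧ k ≤ (j : ℕ) ∧ G.Adj i j then f i - f j else 0)]
  refine (Finset.sum_le_sum fun e he => ?_).trans
    (Finset.sum_le_sum_of_subset_of_nonneg (Finset.subset_univ S) fun e _ _ => ?_)
  · rw [if_pos (hS e he)]
  · split_ifs with h
    · exact sub_nonneg.mpr (hf (by rw [Fin.le_def]; omega))
    · exact le_rfl

theorem sub_le_mul_partialSum_of_adj (hf : Antitone f) (hL : ∀ u, G.laplacian f u = α * f u)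
    {k : ℕ} {i j : Fin n} (hi : (i : ℕ) < k) (hj : k ≤ (j : ℕ)) (hij : G.Adj i j) :
    f i - f j ≤ α * partialSum f k := by
  have := sum_sub_le_mul_partialSum hf hL (k := k) {(i, j)} (by
    intro e he
    rw [Finset.mem_singleton] at he
    subst he
    exact ⟨hi, hj, hij⟩)
  simpa using this

theorem Connected.exists_adj_across (hG : G.Connected) {k : ℕ} (hk : 0 < k) (hkn : k < n) :
    ∃ i j : Fin n, (i : ℕ) < k ∧ k ≤ (j : ℕ) ∧ G.Adj i j := by
  obtain ⟨w⟩ := hG.preconnected ⟨0, by omega⟩ ⟨k, hkn⟩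
  obtain ⟨d, -, h1, h2⟩ := w.exists_boundary_dart {i | (i : ℕ) < k} (by simpa using hk) (by simp)
  exact ⟨d.fst, d.snd, h1, not_lt.mp h2, d.adj⟩

/-- Some edge crosses every gap of the ordering, and it is at least as long as the gap. -/
theorem gap_le_mul_partialSum (hG : G.Connected) (hf : Antitone f)
    (hL : ∀ u, G.laplacian f u = α * f u) {k : ℕ} (hkn : k + 1 < n) :
    f ⟨k, by omega⟩ - f ⟨k + 1, hkn⟩ ≤ α * partialSum f (k + 1) := by
  obtain ⟨i, j, hi, hj, hij⟩ := hG.exists_adj_across (Nat.succ_pos k) hkn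
  have h := sub_le_mul_partialSum_of_adj hf hL hi hj hij
  have h1 : f ⟨k, by omega⟩ ≤ f i := hf (by rw [Fin.le_def]; simp only; omega)
  have h2 : f j ≤ f ⟨k + 1, hkn⟩ := hf (by rw [Fin.le_def]; simp only; omega)
  linarith

/-- If the flow across a gap is the length of the gap, and the values next to the gap are attained
nowhere else across it, then the only edge across joins the two vertices at the gap. -/
theorem eq_of_adj_across (hf : Antitone f) (hL : ∀ u, G.laplacian f u = α * f u) {k : ℕ}
    (hkn : k + 1 < n) (heq : f ⟨k, by omega⟩ - f ⟨k + 1, hkn⟩ = α * partialSum f (k + 1))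
    (hlow : ∀ i : Fin n, (i : ℕ) < k → f ⟨k, by omega⟩ < f i)
    (hhigh : ∀ j : Fin n, k + 1 < (j : ℕ) → f j < f ⟨k + 1, hkn⟩)
    {i j : Fin n} (hi : (i : ℕ) ≤ k) (hj : k < (j : ℕ)) (hij : G.Adj i j) :
    (i : ℕ) = k ∧ (j : ℕ) = k + 1 := by
  have h := sub_le_mul_partialSum_of_adj (k := k + 1) hf hL (by omega) (by omega) hij
  have h1 : f ⟨k, by omega⟩ ≤ f i := hf (by rw [Fin.le_def]; simp only; omega)
  have h2 : f j ≤ f ⟨k + 1, hkn⟩ := hf (by rw [Fin.le_def]; simp only; omega)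
  constructor
  · by_contra hne
    have := hlow i (by omega)
    linarith
  · by_contra hne
    have := hhigh j (by omega)
    linarith

/-- Two cuts through a clique, just after its first and just before its last vertex, together
bound the spread of the eigenvector over the clique. -/
theorem IsClique.mul_sub_le {C : Finset (Fin n)} (hC : G.IsClique C) (hf : Antitone f)
    (hL : ∀ u, G.laplacian f u = α * f u) {p q : Fin n} (hp : p ∈ C) (hq : q ∈ C)
    (hpC : ∀ i ∈ C, p ≤ i) (hqC : ∀ i ∈ C, i ≤ q) :
    C.card * (f p - f q) ≤ α * (partialSum f (p + 1) + partialSum f q) := by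
  classical
  have h1 := sum_sub_le_mul_partialSum hf hL (k := p + 1) ((C.erase p).image fun j => (p, j)) (by
    intro e he
    obtain ⟨j, hj, rfl⟩ := Finset.mem_image.mp he
    obtain ⟨hjp, hjC⟩ := Finset.mem_erase.mp hj
    refine ⟨Nat.lt_succ_self _, ?_, hC hp hjC hjp.symm⟩
    exact lt_of_le_of_ne (hpC j hjC) hjp.symm)
  have h2 := sum_sub_le_mul_partialSum hf hL (k := q) ((C.erase q).image fun j => (j, q)) (by
    intro e he
    obtain ⟨j, hj, rfl⟩ := Finset.mem_image.mp he
    obtain ⟨hjq, hjC⟩ := Finset.mem_erase.mp hj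
    exact ⟨Fin.lt_def.mp (lt_of_le_of_ne (hqC j hjC) hjq), le_rfl, hC hjC hq hjq⟩)
  rw [Finset.sum_image (fun a _ b _ h => (Prod.ext_iff.mp h).2)] at h1
  rw [Finset.sum_image (fun a _ b _ h => (Prod.ext_iff.mp h).1)] at h2
  rw [Finset.sum_erase _ (sub_self _), Finset.sum_sub_distrib] at h1 h2
  simp only [Finset.sum_const, nsmul_eq_mul] at h1 h2
  linarith

end Cut

end SimpleGraph

/-! ### Fiedler vectors -/

namespace SimpleGraph

section Fiedler

variable {V : Type*} [Fintype V]

theorem algebraicConnectivity_pos (G : SimpleGraph V) (hG : G.Connected)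
    (hV : 2 ≤ Fintype.card V) : 0 < G.algebraicConnectivity := by
  classical
  obtain ⟨f, hf, hs, he⟩ := G.exists_fiedler hG hV
  obtain ⟨v, hv⟩ := Function.ne_iff.mp hf
  have hpos : 0 < ∑ w, f w ^ 2 :=
    Finset.sum_pos' (fun w _ => sq_nonneg _) ⟨v, Finset.mem_univ v, by
      have : f v ≠ 0 := hv
      positivity⟩
  have hE : 0 ≤ ∑ u, f u * G.laplacian f u := by
    rw [sum_mul_laplacian_self]
    refine div_nonneg (Finset.sum_nonneg fun u _ => Finset.sum_nonneg fun v _ => ?_) zero_le_two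
    split_ifs
    · exact sq_nonneg _
    · exact le_rfl
  have h1 : ∑ u, f u * G.laplacian f u = G.algebraicConnectivity * ∑ w, f w ^ 2 := by
    rw [Finset.mul_sum]
    exact Finset.sum_congr rfl fun u _ => by rw [he]; ring
  rw [h1] at hE
  have h0 : 0 ≤ G.algebraicConnectivity := nonneg_of_mul_nonneg_left hE hpos
  refine lt_of_le_of_ne h0 fun h => hv ?_
  have hker : (G.lapMatrix ℝ).mulVec f = 0 := by
    rw [lapMatrix_mulVec_eq_laplacian]
    ext u
    rw [he, ← h, zero_mul, Pi.zero_apply]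
  have hconst : ∀ w, f w = f v := fun w =>
    (G.lapMatrix_mulVec_eq_zero_iff_forall_reachable.mp hker) w v (hG.preconnected w v)
  simp only [hconst, Finset.sum_const, nsmul_eq_mul, Finset.card_univ] at hs
  refine (mul_eq_zero.mp hs).resolve_left ?_
  exact_mod_cast (by omega : Fintype.card V ≠ 0)

theorem card_mul_sum_sq (f : V → ℝ) (hf : ∑ u, f u = 0) :
    2 * Fintype.card V * ∑ u, f u ^ 2 = ∑ u, ∑ v, (f u - f v) ^ 2 := by
  have h : ∀ u v, (f u - f v) ^ 2 = f u ^ 2 - 2 * (f u * f v) + f v ^ 2 := fun u v => by ring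
  simp only [h, Finset.sum_add_distrib, Finset.sum_sub_distrib, ← Finset.mul_sum, hf,
    Finset.sum_const, Finset.card_univ, nsmul_eq_mul, mul_zero, sub_zero]
  ring

/-- A function which is closer together along edges and further apart overall than a Fiedler
vector is again an eigenvector, after centring. -/
theorem laplacian_eq_of_rearrangement (G : SimpleGraph V) (hG : G.Connected)
    (hV : 2 ≤ Fintype.card V) {f g : V → ℝ} (hf : ∑ u, f u = 0) (hg : ∑ u, g u = 0)
    (he : ∀ u, G.laplacian f u = G.algebraicConnectivity * f u)
    (hadj : ∀ u v, G.Adj u v → (g u - g v) ^ 2 ≤ (f u - f v) ^ 2)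
    (hall : ∀ u v, (f u - f v) ^ 2 ≤ (g u - g v) ^ 2) (u : V) :
    G.laplacian g u = G.algebraicConnectivity * g u := by
  classical
  refine G.laplacian_eq_of_le hG hV g hg ?_ u
  have h1 : ∑ u, g u * G.laplacian g u ≤ ∑ u, f u * G.laplacian f u := by
    rw [sum_mul_laplacian_self, sum_mul_laplacian_self]
    refine div_le_div_of_nonneg_right
      (Finset.sum_le_sum fun u _ => Finset.sum_le_sum fun v _ => ?_) zero_le_two
    split_ifs with h
    · exact hadj u v h
    · exact le_rfl
  have h2 : ∑ u, f u * G.laplacian f u = G.algebraicConnectivity * ∑ w, f w ^ 2 := by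
    rw [Finset.mul_sum]
    exact Finset.sum_congr rfl fun u _ => by rw [he]; ring
  have h3 : ∑ w, f w ^ 2 ≤ ∑ w, g w ^ 2 := by
    have hn : (0 : ℝ) < 2 * Fintype.card V := by
      have : 0 < Fintype.card V := by omega
      positivity
    refine le_of_mul_le_mul_left ?_ hn
    rw [card_mul_sum_sq f hf, card_mul_sum_sq g hg]
    exact Finset.sum_le_sum fun u _ => Finset.sum_le_sum fun v _ => hall u v
  rw [h2] at h1
  exact h1.trans (mul_le_mul_of_nonneg_left h3 (G.algebraicConnectivity_pos hG hV).le)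

theorem laplacian_sub_const (G : SimpleGraph V) (f : V → ℝ) (x : ℝ) (u : V) :
    G.laplacian (fun v => f v - x) u = G.laplacian f u := by
  simp [laplacian]

end Fiedler

end SimpleGraph

/-! ### The Fiedler vector of the kite -/

section Kite

open SimpleGraph

theorem kiteGraph_adj {n r : ℕ} {i j : Fin n} : (kiteGraph n r).Adj i j ↔ i ≠ j ∧
    (((i : ℕ) < r ∧ (j : ℕ) < r) ∨ (i : ℕ) + 1 = (j : ℕ) ∨ (j : ℕ) + 1 = (i : ℕ)) := Iff.rfl

theorem kiteGraph_connected {n r : ℕ} (hn : 0 < n) : (kiteGraph n r).Connected := by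
  have h : ∀ k (hk : k < n), (kiteGraph n r).Reachable ⟨0, hn⟩ ⟨k, hk⟩ := by
    intro k
    induction k with
    | zero => intro _; exact Reachable.refl _
    | succ k ih =>
      intro hk
      refine (ih (by omega)).trans (Adj.reachable ?_)
      rw [kiteGraph_adj]
      exact ⟨by simp [Fin.ext_iff], Or.inr (Or.inl rfl)⟩
  have : Nonempty (Fin n) := ⟨⟨0, hn⟩⟩
  exact ⟨fun u v => (h u u.2).symm.trans (h v v.2)⟩

variable {c l : ℕ}

/-- The centred indicator of the pendant vertex bounds the algebraic connectivity of a kite with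
a nonempty path. -/
theorem kiteGraph_algebraicConnectivity_lt (hl : 1 ≤ l) :
    (kiteGraph (c + 2 + l) (c + 2)).algebraicConnectivity < c + 2 := by
  set n := c + 2 + l with hn
  set G := kiteGraph n (c + 2) with hGdef
  have hG : G.Connected := kiteGraph_connected (by omega)
  have hV : 2 ≤ Fintype.card (Fin n) := by rw [Fintype.card_fin]; omega
  have hα := G.algebraicConnectivity_pos hG hV
  set α := G.algebraicConnectivity
  set z : Fin n := ⟨n - 1, by omega⟩ with hz
  set y : Fin n := ⟨n - 2, by omega⟩ with hy
  have hyz : y ≠ z := by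
    rw [Ne, Fin.ext_iff]
    simp only [hz, hy]
    omega
  set δ : Fin n → ℝ := fun i => if i = z then 1 else 0 with hδ
  have hn3 : (3 : ℝ) ≤ n := by exact_mod_cast (by omega : 3 ≤ n)
  have hn0 : (n : ℝ) ≠ 0 := by linarith
  have hδs : ∑ i, δ i = 1 := by simp [hδ]
  have hLz : G.laplacian δ z = 1 := by
    classical
    rw [laplacian, Finset.sum_eq_single y]
    · rw [if_pos]
      · simp [hδ, hyz]
      · rw [hGdef, kiteGraph_adj]
        refine ⟨hyz.symm, Or.inr (Or.inr ?_)⟩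
        simp only [hz, hy]
        omega
    · intro j _ hj
      rw [if_neg]
      rw [hGdef, kiteGraph_adj]
      rintro ⟨hne, h⟩
      have h1 : (j : ℕ) ≠ n - 1 := fun h' => hne (Fin.ext h'.symm)
      have h2 : (j : ℕ) ≠ n - 2 := fun h' => hj (Fin.ext h')
      simp only [hz] at h
      omega
    · simp
  have h := G.algebraicConnectivity_mul_le hG hV (fun i => δ i - (n : ℝ)⁻¹) (by
    rw [Finset.sum_sub_distrib, hδs]
    simp [hn0])
  have h1 : ∑ i, (δ i - (n : ℝ)⁻¹) * G.laplacian (fun i => δ i - (n : ℝ)⁻¹) i = 1 := by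
    simp only [laplacian_sub_const, sub_mul, Finset.sum_sub_distrib, ← Finset.mul_sum,
      sum_laplacian, mul_zero, sub_zero]
    rw [Finset.sum_eq_single z]
    · rw [hLz]; simp [hδ]
    · intro j _ hj; simp [hδ, hj]
    · simp
  have h2 : ∑ i, (δ i - (n : ℝ)⁻¹) ^ 2 = 1 - (n : ℝ)⁻¹ := by
    have : ∀ i, (δ i - (n : ℝ)⁻¹) ^ 2 = δ i - 2 * (n : ℝ)⁻¹ * δ i + (n : ℝ)⁻¹ ^ 2 := by
      intro i
      by_cases hi : i = z <;> simp [hδ, hi]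
      ring
    simp only [this, Finset.sum_add_distrib, Finset.sum_sub_distrib, ← Finset.mul_sum, hδs,
      Finset.sum_const, Finset.card_univ, Fintype.card_fin, nsmul_eq_mul]
    field_simp
    ring
  rw [h1, h2] at h
  have h3 : (n : ℝ)⁻¹ ≤ 1 / 3 := by
    rw [one_div]
    exact inv_anti₀ (by norm_num) hn3
  have h4 : (0 : ℝ) ≤ c := Nat.cast_nonneg c
  change α < _
  nlinarith

theorem kiteGraph_laplacian_clique (h : Fin (c + 2 + l) → ℝ) {i : Fin (c + 2 + l)}
    (hi : (i : ℕ) < c + 1) : (kiteGraph (c + 2 + l) (c + 2)).laplacian h i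
      = (c + 2) * h i - partialSum h (c + 2) := by
  have h1 := partialSum_const (h i) (show c + 2 ≤ c + 2 + l by omega)
  push_cast at h1
  rw [← h1, partialSum, partialSum, laplacian, ← Finset.sum_sub_distrib]
  refine Finset.sum_congr rfl fun j _ => ?_
  by_cases hij : i = j
  · subst hij
    split_ifs <;> simp
  · have hij' : (i : ℕ) ≠ j := fun h => hij (Fin.ext h)
    by_cases hj : (j : ℕ) < c + 2
    · rw [if_pos (kiteGraph_adj.mpr ⟨hij, Or.inl ⟨by omega, hj⟩⟩), if_pos hj, if_pos hj]
    · rw [if_neg, if_neg hj, if_neg hj, sub_zero]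
      rw [kiteGraph_adj]
      omega

theorem kiteGraph_eq_on_clique (hl : 1 ≤ l) {h : Fin (c + 2 + l) → ℝ}
    (he : ∀ u, (kiteGraph (c + 2 + l) (c + 2)).laplacian h u
      = (kiteGraph (c + 2 + l) (c + 2)).algebraicConnectivity * h u)
    {i j : Fin (c + 2 + l)} (hi : (i : ℕ) < c + 1) (hj : (j : ℕ) < c + 1) : h i = h j := by
  have h1 := he i
  have h2 := he j
  rw [kiteGraph_laplacian_clique h hi] at h1
  rw [kiteGraph_laplacian_clique h hj] at h2
  have h3 := kiteGraph_algebraicConnectivity_lt (c := c) hl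
  have h4 : (c + 2 - (kiteGraph (c + 2 + l) (c + 2)).algebraicConnectivity) * (h i - h j) = 0 := by
    linarith
  linarith [(mul_eq_zero.mp h4).resolve_left (by linarith)]

/-- The kite has a decreasing Fiedler vector: making all the steps of a Fiedler vector along the
vertex order point downwards keeps the differences along the edges and does not decrease any
other difference. -/
theorem kiteGraph_exists_antitone_fiedler (hl : 1 ≤ l) :
    ∃ h : Fin (c + 2 + l) → ℝ, h ≠ 0 ∧ Antitone h ∧ ∑ u, h u = 0 ∧
      ∀ u, (kiteGraph (c + 2 + l) (c + 2)).laplacian h u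
        = (kiteGraph (c + 2 + l) (c + 2)).algebraicConnectivity * h u := by
  set n := c + 2 + l with hn
  set G := kiteGraph n (c + 2) with hGdef
  have hG : G.Connected := kiteGraph_connected (by omega)
  have hV : 2 ≤ Fintype.card (Fin n) := by rw [Fintype.card_fin]; omega
  obtain ⟨f, hf, hs, he⟩ := G.exists_fiedler hG hV
  have hclique : ∀ i j : Fin n, (i : ℕ) < c + 1 → (j : ℕ) < c + 1 → f i = f j :=
    fun i j hi hj => kiteGraph_eq_on_clique hl he hi hj
  set F : ℕ → ℝ := fun k => if hk : k < n then f ⟨k, hk⟩ else 0 with hF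
  have hFf : ∀ i : Fin n, F i = f i := fun i => by simp [hF]
  set y : ℕ → ℝ := fun k => ∑ j ∈ Finset.range k, |F j - F (j + 1)| with hy
  have hy_sub : ∀ {a b : ℕ}, a ≤ b → y b - y a = ∑ j ∈ Finset.Ico a b, |F j - F (j + 1)| := by
    intro a b hab
    rw [Finset.sum_Ico_eq_sub _ hab]
  have hfar : ∀ {a b : ℕ}, a ≤ b → |F a - F b| ≤ y b - y a := by
    intro a b hab
    rw [hy_sub hab]
    simpa only [Real.dist_eq] using dist_le_Ico_sum_dist F hab
  have hmono : ∀ {a b : ℕ}, a ≤ b → y a ≤ y b := fun hab =>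
    sub_nonneg.mp ((abs_nonneg _).trans (hfar hab))
  have hflat : ∀ {a b : ℕ}, a ≤ b → b < c + 1 → y b - y a = 0 := by
    intro a b hab hb
    rw [hy_sub hab]
    refine Finset.sum_eq_zero fun j hj => ?_
    rw [Finset.mem_Ico] at hj
    have h1 : F j = f ⟨j, by omega⟩ := hFf ⟨j, by omega⟩
    have h2 : F (j + 1) = f ⟨j + 1, by omega⟩ := hFf ⟨j + 1, by omega⟩
    rw [h1, h2, hclique ⟨j, by omega⟩ ⟨j + 1, by omega⟩ (show j < c + 1 by omega)
      (show j + 1 < c + 1 by omega), sub_self, abs_zero]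
  have hstep : ∀ k, y (k + 1) - y k = |F k - F (k + 1)| := fun k => by
    simp [hy, Finset.sum_range_succ]
  have hnear : ∀ i j : Fin n, (i : ℕ) ≤ j → G.Adj i j → y j - y i ≤ |F i - F j| := by
    intro i j hij hadj
    rw [hGdef, kiteGraph_adj] at hadj
    obtain ⟨hne, h⟩ := hadj
    have hne' : (i : ℕ) ≠ j := fun h => hne (Fin.ext h)
    by_cases hj : (j : ℕ) < c + 1
    · rw [hflat hij hj]
      exact abs_nonneg _
    · by_cases hs : (i : ℕ) + 1 = j
      · rw [← hs, hstep]
      · -- `j` is the vertex of the clique carrying the path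
        have hjc : (j : ℕ) = c + 1 := by omega
        have h1 : F i = F c := by
          rw [hFf]
          have h2 : F c = f ⟨c, by omega⟩ := hFf ⟨c, by omega⟩
          rw [h2]
          exact hclique _ _ (by omega) (by simp)
        have h3 := hflat (show (i : ℕ) ≤ c by omega) (by omega)
        have h4 := hstep c
        rw [hjc, h1, ← h4]
        linarith
  set m : ℝ := (∑ i : Fin n, -y i) / n with hm
  have hn0 : (n : ℝ) ≠ 0 := by exact_mod_cast (by omega : n ≠ 0)
  have hall : ∀ i j : Fin n, (f i - f j) ^ 2 ≤ (-y i - m - (-y j - m)) ^ 2 := by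
    intro i j
    rw [← hFf, ← hFf]
    rcases le_total (i : ℕ) j with hij | hij
    · have := hfar hij
      rw [sq_le_sq, show -y i - m - (-y j - m) = y j - y i by ring]
      exact this.trans (le_abs_self _)
    · have := hfar hij
      rw [sq_le_sq, abs_sub_comm (F i), show -y i - m - (-y j - m) = -(y i - y j) by ring, abs_neg]
      exact this.trans (le_abs_self _)
  have hadj : ∀ i j : Fin n, G.Adj i j → (-y i - m - (-y j - m)) ^ 2 ≤ (f i - f j) ^ 2 := by
    intro i j hij
    rw [← hFf, ← hFf]
    rcases le_total (i : ℕ) j with hle | hle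
    · rw [sq_le_sq, show -y i - m - (-y j - m) = y j - y i by ring,
        abs_of_nonneg (sub_nonneg.mpr (hmono hle))]
      exact hnear i j hle hij
    · rw [sq_le_sq, abs_sub_comm (F i), show -y i - m - (-y j - m) = -(y i - y j) by ring, abs_neg,
        abs_of_nonneg (sub_nonneg.mpr (hmono hle))]
      exact hnear j i hle hij.symm
  have hgs : ∑ i : Fin n, (-y i - m) = 0 := by
    rw [Finset.sum_sub_distrib, Finset.sum_const, Finset.card_univ, Fintype.card_fin,
      nsmul_eq_mul, hm]
    field_simp
    ring
  refine ⟨fun i => -y i - m, ?_, ?_, hgs, ?_⟩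
  · intro h0
    apply hf
    have hz : ∀ i j, f i = f j := by
      intro i j
      have h1 := hall i j
      have h2 := congrFun h0 i
      have h3 := congrFun h0 j
      simp only [Pi.zero_apply] at h2 h3
      rw [h2, h3] at h1
      have : (f i - f j) ^ 2 = 0 := le_antisymm (by simpa using h1) (sq_nonneg _)
      linarith [pow_eq_zero_iff (two_ne_zero) |>.mp this]
    ext i
    have : ∑ j : Fin n, f j = n * f i := by
      rw [Finset.sum_congr rfl fun j _ => hz j i]
      simp
    rw [hs] at this
    exact (mul_eq_zero.mp this.symm).resolve_left hn0
  · intro i j hij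
    have := hmono (Fin.le_def.mp hij)
    simp only
    linarith
  · exact G.laplacian_eq_of_rearrangement hG hV hs hgs he hadj hall

theorem kiteGraph_isKiteValue (hl : 1 ≤ l) :
    IsKiteValue c l (kiteGraph (c + 2 + l) (c + 2)).algebraicConnectivity := by
  classical
  set n := c + 2 + l with hn
  set G := kiteGraph n (c + 2) with hGdef
  obtain ⟨h, hne, hanti, hs, he⟩ : ∃ h : Fin n → ℝ, h ≠ 0 ∧ Antitone h ∧ ∑ u, h u = 0 ∧
      ∀ u, G.laplacian h u = G.algebraicConnectivity * h u :=
    kiteGraph_exists_antitone_fiedler hl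
  have hlt : G.algebraicConnectivity < c + 2 := kiteGraph_algebraicConnectivity_lt hl
  have hclique : ∀ {i j : Fin n}, (i : ℕ) < c + 1 → (j : ℕ) < c + 1 → h i = h j :=
    kiteGraph_eq_on_clique hl he
  have hlap : ∀ {i : Fin n}, (i : ℕ) < c + 1 →
      G.laplacian h i = (c + 2) * h i - partialSum h (c + 2) := kiteGraph_laplacian_clique h
  have hG : G.Connected := kiteGraph_connected (by omega)
  have hV : 2 ≤ Fintype.card (Fin n) := by rw [Fintype.card_fin]; omega
  have hα := G.algebraicConnectivity_pos hG hV
  set α := G.algebraicConnectivity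
  set X := partialSum h with hX
  -- along the path the only edge across a cut is the path edge
  have hrec : ∀ k, c + 1 ≤ k → k + 1 < n → X (k + 2) - 2 * X (k + 1) + X k = -α * X (k + 1) := by
    intro k hk hkn
    have h1 := partialSum_laplacian G h (k + 1)
    rw [partialSum_eigen he, Finset.sum_eq_single ⟨k, by omega⟩,
      Finset.sum_eq_single ⟨k + 1, hkn⟩, if_pos] at h1
    · have h2 := partialSum_succ h (show k < n by omega)
      have h3 := partialSum_succ h hkn
      simp only [hX]
      rw [← h2, ← h3] at h1
      linarith
    · refine ⟨by simp, by simp, ?_⟩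
      rw [hGdef, kiteGraph_adj]
      exact ⟨by simp [Fin.ext_iff], Or.inr (Or.inl rfl)⟩
    · intro j _ hj
      rw [if_neg]
      rintro ⟨-, h2, h3⟩
      rw [hGdef, kiteGraph_adj] at h3
      have : (j : ℕ) ≠ k + 1 := fun h' => hj (Fin.ext h')
      simp only at h3
      omega
    · simp
    · intro i _ hi
      refine Finset.sum_eq_zero fun j _ => ?_
      rw [if_neg]
      rintro ⟨h1, h2, h3⟩
      rw [hGdef, kiteGraph_adj] at h3
      have : (i : ℕ) ≠ k := fun h' => hi (Fin.ext h')
      omega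
    · simp
  have hpos : ∀ k, 0 < k → k < n → 0 < X k := fun k h1 h2 => partialSum_pos hanti hne hs h1 h2
  have hY := eq_mul_pathSeq (μ := α) (Y := fun i => X (n - i)) (M := l)
    (by simp only [Nat.sub_zero, hX, partialSum_self, hs]) (by
      intro i hi
      have h1 := hrec (n - (i + 2)) (by omega) (by omega)
      rw [show n - (i + 2) + 2 = n - i by omega, show n - (i + 2) + 1 = n - (i + 1) by omega] at h1
      linarith)
  have hX1 : 0 < X (n - 1) := hpos _ (by omega) (by omega)
  refine ⟨hα, hlt, ?_, ?_⟩
  · intro i h1 h2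
    have h3 := hpos (n - i) (by omega) (by omega)
    rw [hY i h2] at h3
    exact pos_of_mul_pos_right h3 hX1.le
  · have h1 := hY l (by omega)
    have h2 := hY (l + 1) le_rfl
    rw [show n - l = c + 2 by omega] at h1
    rw [show n - (l + 1) = c + 1 by omega] at h2
    set z : Fin n := ⟨0, by omega⟩
    have h3 : X (c + 1) = (c + 1) * h z := by
      have := partialSum_const (n := n) (h z) (show c + 1 ≤ n by omega)
      push_cast at this
      rw [← this]
      refine Finset.sum_congr rfl fun i _ => ?_
      split_ifs with hi
      · exact hclique hi (by simp [z])
      · rfl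
    have h4 := hlap (i := z) (by simp [z])
    rw [he] at h4
    have h5 : (c + 1) * X (c + 2) = (c + 2 - α) * X (c + 1) := by
      simp only [hX] at h3 ⊢
      rw [h3]
      linear_combination ((c : ℝ) + 1) * h4
    rw [h1, h2] at h5
    apply mul_left_cancel₀ hX1.ne'
    linear_combination h5

end Kite

/-! ### Comparison with the kite -/

namespace SimpleGraph

section Ordered

variable {c l : ℕ} {μ α : ℝ} {G : SimpleGraph (Fin (c + 2 + l))} {f : Fin (c + 2 + l) → ℝ}

/-- The comparison of a decreasing Fiedler vector with the kite. The window of `c + 2` consecutive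
positions starting at `a` plays the role of the clique, and `a` is small enough for the
estimate to run from this side. Then `a = 0` and every inequality used is an equality. -/
theorem rigidity_of_window {n : ℕ} (hn : n = c + 2 + l) {G : SimpleGraph (Fin n)}
    {f : Fin n → ℝ} (hμ : IsKiteValue c l μ) (hG : G.Connected) (hf : Antitone f)
    (hne : f ≠ 0) (hs : ∑ u, f u = 0) (hL : ∀ u, G.laplacian f u = α * f u) (hαμ : α ≤ μ)
    {a b : ℕ} (hab : a + b = l) (hc : c = 0 → a = 0)
    (hside : pathSeq μ a ≤ (1 - μ / (c + 2)) * pathSeq μ (a + 1))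
    (hwin : (c + 2) * (f ⟨a, by omega⟩ - f ⟨a + c + 1, by omega⟩)
      ≤ α * (partialSum f (a + 1) + partialSum f (a + c + 1))) :
    a = 0 ∧ α = μ ∧
      (∀ k, c + 1 ≤ k → (hk : k + 1 < n) →
        f ⟨k, by omega⟩ - f ⟨k + 1, hk⟩ = α * partialSum f (k + 1)) ∧
      partialSum f (a + c + 1) = (c + 1) * f ⟨a, by omega⟩ ∧
      (c + 2) * (f ⟨a, by omega⟩ - f ⟨a + c + 1, by omega⟩)
        = α * (partialSum f (a + 1) + partialSum f (a + c + 1)) := by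
  set X := partialSum f with hX
  have hX0 : X 0 = 0 := partialSum_zero f
  have hXn : X n = 0 := by rw [hX, partialSum_self, hs]
  have hpos : ∀ k, 0 < k → k < n → 0 < X k := fun k h1 h2 => partialSum_pos hf hne hs h1 h2
  have hgap : ∀ k, k + 1 < n → (2 - μ) * X (k + 1) ≤ X (k + 2) + X k := by
    intro k hk
    have h1 := gap_le_mul_partialSum hG hf hL hk
    rw [← partialSum_succ f (show k < n by omega), ← partialSum_succ f hk] at h1
    have h2 := mul_le_mul_of_nonneg_right hαμ (hpos (k + 1) (by omega) hk).le
    simp only [← hX] at h1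
    linarith
  -- the same inequalities read from the other end
  have hgap' : ∀ i, i + 1 < n →
      (2 - μ) * X (n - (i + 1)) ≤ X (n - (i + 2)) + X (n - i) := by
    intro i hi
    have h := hgap (n - (i + 2)) (by omega)
    rw [show n - (i + 2) + 1 = n - (i + 1) by omega, show n - (i + 2) + 2 = n - i by omega] at h
    linarith
  have hPpos := hμ.pathSeq_pos
  have hPa := hPpos (a + 1) (by omega) (by omega)
  have hPb := hPpos (b + 1) (by omega) (by omega)
  have hPnn : ∀ i ≤ l, 0 ≤ pathSeq μ i := fun i hi => by
    rcases Nat.eq_zero_or_pos i with rfl | hi'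
    · simp [pathSeq]
    · exact (hPpos i hi' (by omega)).le
  have hcmp := mul_pathSeq_le (μ := μ) (X := X) (M := a) hX0
    (fun i h1 h2 => hPpos i h1 (by omega)) (fun i hi => hgap i (by omega))
  have hcmp' := mul_pathSeq_le (μ := μ) (X := fun i => X (n - i)) (M := b) hXn
    (fun i h1 h2 => hPpos i h1 (by omega)) (fun i hi => hgap' i (by omega))
  have hcmp'' := eq_of_mul_pathSeq_eq (μ := μ) (X := fun i => X (n - i)) (M := b) hXn
    (fun i h1 h2 => hPpos i h1 (by omega)) (fun i hi => hgap' i (by omega))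
  simp only [show n - b = a + c + 2 by omega, show n - (b + 1) = a + c + 1 by omega]
    at hcmp' hcmp''
  have hA := hpos (a + 1) (by omega) (by omega)
  have hB := hpos (a + c + 1) (by omega) (by omega)
  have hfa : X (a + 1) - X a = f ⟨a, by omega⟩ := partialSum_succ f (by omega)
  have hfb : X (a + c + 2) - X (a + c + 1) = f ⟨a + c + 1, by omega⟩ :=
    partialSum_succ f (by omega)
  have hBA : X (a + c + 1) ≤ X (a + 1) + c * f ⟨a, by omega⟩ :=
    partialSum_le_add_mul hf (by omega) (by omega)
  set x₀ := f ⟨a, by omega⟩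
  set y₀ := f ⟨a + c + 1, by omega⟩
  set A := X (a + 1) with hAdef
  set B := X (a + c + 1) with hBdef
  obtain ⟨s, hsd⟩ : ∃ s, pathSeq μ a = s * pathSeq μ (a + 1) :=
    ⟨pathSeq μ a / pathSeq μ (a + 1), by field_simp⟩
  obtain ⟨t, htd⟩ : ∃ t, pathSeq μ b = t * pathSeq μ (b + 1) :=
    ⟨pathSeq μ b / pathSeq μ (b + 1), by field_simp⟩
  have hs0 : 0 ≤ s := nonneg_of_mul_nonneg_left (hsd ▸ hPnn a (by omega)) hPa
  have ht0 : 0 ≤ t := nonneg_of_mul_nonneg_left (htd ▸ hPnn b (by omega)) hPb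
  have hc0 : (0 : ℝ) ≤ c := Nat.cast_nonneg c
  have hμ0 := hμ.pos
  have hκ : 0 < μ / (c + 2) := by positivity
  have hκ1 : μ / (c + 2) < 1 := (div_lt_one (by positivity)).mpr hμ.lt
  have hid := hμ.split_identity hab hsd htd
  have hsκ : s ≤ 1 - μ / (c + 2) := by
    rw [hsd] at hside
    exact le_of_mul_le_mul_right hside hPa
  have hxs : X a ≤ s * A := by
    rw [hsd] at hcmp
    refine le_of_mul_le_mul_right ?_ hPa
    linarith
  have hyt : X (a + c + 2) ≤ t * B := by
    rw [htd] at hcmp'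
    refine le_of_mul_le_mul_right ?_ hPb
    linarith
  have hAx : A * (x₀ / A) = x₀ := by field_simp
  have hBy : B * (-y₀ / B) = -y₀ := by field_simp
  have hwin' : (c + 2) * (x₀ - y₀) ≤ μ * (A + B) :=
    hwin.trans (mul_le_mul_of_nonneg_right hαμ (by linarith))
  have hdiv : μ / (c + 2) * (c + 2) = μ := by field_simp
  have hlow : A * (x₀ / A - μ / (c + 2)) + B * (-y₀ / B - μ / (c + 2))
      = x₀ - y₀ - μ / (c + 2) * (A + B) := by
    rw [mul_sub, mul_sub, hAx, hBy]
    ring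
  have hs_of : c * s = 0 → s = 0 := by
    intro h
    rcases mul_eq_zero.mp h with h | h
    · have := hc (by exact_mod_cast h)
      subst this
      simp only [pathSeq] at hsd
      simpa using hsd.symm
    · exact h
  obtain ⟨h1, h2, h3, h4, h5⟩ := eq_of_two_sided_le (A := A) (B := B) (c := c) (x := x₀ / A)
    (y := -y₀ / B) (p := 1 - s) (q := 1 - t) (κ := μ / (c + 2)) hA hB hc0 hκ hκ1
    (by rw [le_div_iff₀ hA]; linarith) (by rw [le_div_iff₀ hB]; linarith) (by linarith)
    (by rw [mul_add, mul_one, mul_left_comm, hAx]; exact hBA)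
    (by
      rw [hlow, sub_nonpos]
      refine le_of_mul_le_mul_left (a := (c : ℝ) + 2) ?_ (by positivity)
      rw [← mul_assoc, mul_comm ((c : ℝ) + 2) (μ / _), hdiv]
      exact hwin')
    (by rw [hid]; positivity)
    (by
      intro h
      rw [hid] at h
      have h6 : c * s = 0 := by
        have h7 : μ / (c + 2) * (1 + (c + 2) * t) * (c * s) = 0 := by linarith
        exact (mul_eq_zero.mp h7).resolve_left (by positivity)
      rw [hs_of h6, sub_zero])
  have hs' : s = 0 := by linarith
  have ha : a = 0 := by
    by_contra hane
    have := hPpos a (by omega) (by omega)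
    rw [hsd, hs', zero_mul] at this
    exact lt_irrefl _ this
  have h6 : (c + 2) * (x₀ - y₀) = μ * (A + B) := by
    rw [hlow] at h5
    have : x₀ - y₀ = μ / (c + 2) * (A + B) := by linarith
    rw [this, ← mul_assoc, mul_comm ((c : ℝ) + 2), hdiv]
  have hα : α = μ := by
    refine le_antisymm hαμ ?_
    rw [h6] at hwin
    exact le_of_mul_le_mul_right hwin (by linarith)
  have hxA : x₀ = A := by rw [← hAx, h2, hs']; ring
  refine ⟨ha, hα, ?_, ?_, by rw [h6, hα]⟩
  · intro k hk hkn
    have hyt' : X (a + c + 2) * pathSeq μ (b + 1) = B * pathSeq μ b := by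
      rw [h3] at hBy
      rw [htd, ← mul_assoc]
      congr 1
      linarith
    have h7 := hcmp'' hyt' (i := n - (k + 2)) (by omega)
    rw [show n - (n - (k + 2) + 2) = k by omega, show n - (n - (k + 2)) = k + 2 by omega,
      show n - (n - (k + 2) + 1) = k + 1 by omega] at h7
    have h8 : X (k + 1) - X k = f ⟨k, by omega⟩ := partialSum_succ f (by omega)
    have h9 : X (k + 2) - X (k + 1) = f ⟨k + 1, hkn⟩ := partialSum_succ f hkn
    rw [← h8, ← h9, hα]
    linarith
  · rw [h4, h2, hs', hxA]
    ring

/-- A graph on an ordered vertex set whose initial segment is a clique, and in which each later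
cut is crossed only by the edge between consecutive vertices, is the kite. -/
theorem eq_kiteGraph (hG : G.Connected)
    (hclique : ∀ i j : Fin (c + 2 + l), (i : ℕ) < c + 2 → (j : ℕ) < c + 2 → i ≠ j → G.Adj i j)
    (hcut : ∀ k, c + 1 ≤ k → k + 1 < c + 2 + l → ∀ i j : Fin (c + 2 + l), (i : ℕ) ≤ k →
      k < (j : ℕ) → G.Adj i j → (i : ℕ) = k ∧ (j : ℕ) = k + 1) :
    G = kiteGraph (c + 2 + l) (c + 2) := by
  have key : ∀ i j : Fin (c + 2 + l), (i : ℕ) < j →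
      (G.Adj i j ↔ (kiteGraph (c + 2 + l) (c + 2)).Adj i j) := by
    intro i j hij
    have hne : i ≠ j := fun h => hij.ne (congrArg Fin.val h)
    have hj := j.2
    rw [kiteGraph_adj]
    by_cases hjc : (j : ℕ) < c + 2
    · exact ⟨fun _ => ⟨hne, Or.inl ⟨by omega, hjc⟩⟩, fun _ => hclique i j (by omega) hjc hne⟩
    · constructor
      · intro h
        have := hcut (j - 1) (by omega) (by omega) i j (by omega) (by omega) h
        exact ⟨hne, Or.inr (Or.inl (by omega))⟩
      · rintro ⟨-, h⟩
        have hi : (i : ℕ) + 1 = j := by omega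
        obtain ⟨i', j', h1, h2, h3⟩ := hG.exists_adj_across (k := j) (by omega) j.2
        have h4 := hcut (j - 1) (by omega) (by omega) i' j' (by omega) (by omega) h3
        have h5 : i' = i := Fin.ext (by omega)
        have h6 : j' = j := Fin.ext (by omega)
        rwa [h5, h6] at h3
  ext i j
  rcases lt_trichotomy (i : ℕ) j with h | h | h
  · exact key i j h
  · rw [Fin.ext h]
    simp
  · rw [G.adj_comm, (kiteGraph _ _).adj_comm]
    exact key j i h

/-- When the equalities of `rigidity_of_window` hold with `a = 0`, the values decrease strictly from
position `c` on, so each cut beyond the clique is crossed only by the edge between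
consecutive vertices. -/
theorem eq_of_adj_across_of_rigid (hf : Antitone f) (hne : f ≠ 0) (hs : ∑ u, f u = 0)
    (hL : ∀ u, G.laplacian f u = α * f u) (hα : 0 < α)
    (hgap : ∀ k, c + 1 ≤ k → (hk : k + 1 < c + 2 + l) →
        f ⟨k, by omega⟩ - f ⟨k + 1, hk⟩ = α * partialSum f (k + 1))
    (hX : partialSum f (c + 1) = (c + 1) * f ⟨0, by omega⟩)
    (hwin : (c + 2) * (f ⟨0, by omega⟩ - f ⟨c + 1, by omega⟩)
        = α * (partialSum f 1 + partialSum f (c + 1)))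
    (hl : 1 ≤ l) (k : ℕ) (hk : c + 1 ≤ k) (hkn : k + 1 < c + 2 + l) (i j : Fin (c + 2 + l))
    (hi : (i : ℕ) ≤ k) (hj : k < (j : ℕ)) (hij : G.Adj i j) : (i : ℕ) = k ∧ (j : ℕ) = k + 1 := by
  have hpos : ∀ k, 0 < k → k < c + 2 + l → 0 < partialSum f k :=
    fun k h1 h2 => partialSum_pos hf hne hs h1 h2
  have hc0 : (0 : ℝ) ≤ c := Nat.cast_nonneg c
  -- the clique vertices other than the last all have the top value
  have htop : f ⟨0, by omega⟩ ≤ f ⟨c, by omega⟩ := by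
    rcases Nat.eq_zero_or_pos c with rfl | hcpos
    · exact le_rfl
    · obtain ⟨d, rfl⟩ : ∃ d, c = d + 1 := ⟨c - 1, by omega⟩
      have h1 := partialSum_le_add_mul hf (show d + 1 = 0 + 1 + d by omega) (by omega)
      have h2 := partialSum_succ f (show 0 < d + 1 + 2 + l by omega)
      have h3 := partialSum_succ f (show d + 1 < d + 1 + 2 + l by omega)
      rw [partialSum_zero, sub_zero] at h2
      rw [h2] at h1
      push_cast at hX
      linarith
  have hdrop : ∀ k, c ≤ k → (hk : k + 1 < c + 2 + l) → f ⟨k + 1, hk⟩ < f ⟨k, by omega⟩ := by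
    intro k hk hkn
    rcases hk.eq_or_lt with rfl | hk'
    · have h1 : 0 < α * (partialSum f 1 + partialSum f (c + 1)) :=
        mul_pos hα (add_pos (hpos _ (by omega) (by omega)) (hpos _ (by omega) (by omega)))
      rw [← hwin] at h1
      linarith [pos_of_mul_pos_right h1 (by linarith)]
    · have := hgap k hk' hkn
      have h1 := mul_pos hα (hpos (k + 1) (by omega) hkn)
      linarith
  refine eq_of_adj_across hf hL hkn (hgap k hk hkn) ?_ ?_ hi hj hij
  · intro i' hi'
    have h1 := hdrop (k - 1) (by omega) (by omega)
    simp only [show k - 1 + 1 = k by omega] at h1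
    exact h1.trans_le (hf (by rw [Fin.le_def]; simp only; omega))
  · intro j' hj'
    have h1 := hdrop (k + 1) (by omega) (by omega)
    exact (hf (by rw [Fin.le_def]; simp only; omega)).trans_lt h1

theorem eq_kiteGraph_of_le_of_zero {G : SimpleGraph (Fin (0 + 2 + l))}
    {f : Fin (0 + 2 + l) → ℝ} (hl : 1 ≤ l) (hμ : IsKiteValue 0 l μ) (hG : G.Connected)
    (hf : Antitone f) (hne : f ≠ 0) (hs : ∑ u, f u = 0)
    (hL : ∀ u, G.laplacian f u = α * f u) (hαμ : α ≤ μ) :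
    G = kiteGraph (0 + 2 + l) (0 + 2) := by
  have hgap0 := gap_le_mul_partialSum hG hf hL (k := 0) (by omega)
  have hlt := hμ.lt
  obtain ⟨-, h1, h2, h3, h4⟩ := rigidity_of_window rfl hμ hG hf hne hs hL hαμ (a := 0) (b := l)
    (by omega) (fun _ => rfl) (by
      simp only [pathSeq, CharP.cast_eq_zero, zero_add, mul_one] at hlt ⊢
      linarith) (by
      simp only [CharP.cast_eq_zero, zero_add] at hgap0 ⊢
      linarith)
  have hcut := eq_of_adj_across_of_rigid hf hne hs hL (h1 ▸ hμ.pos) h2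
    (by simpa using h3) (by simpa using h4) hl
  refine eq_kiteGraph hG ?_ hcut
  -- the edge across the first cut has to end at the second vertex
  have h01 : G.Adj ⟨0, by omega⟩ ⟨1, by omega⟩ := by
    obtain ⟨i, j, hi, hj, hij⟩ := hG.exists_adj_across (k := 1) (by omega) (by omega)
    have hj1 : (j : ℕ) = 1 := by
      by_contra hne
      have := j.2
      have := hcut (j - 1) (by omega) (by omega) i j (by omega) (by omega) hij
      omega
    have e1 : i = ⟨0, by omega⟩ := Fin.ext (by simp only; omega)
    have e2 : j = ⟨1, by omega⟩ := Fin.ext (by simp only; omega)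
    rwa [e1, e2] at hij
  intro i j hi hj hij
  have hij' : (i : ℕ) ≠ j := fun h => hij (Fin.ext h)
  rcases Nat.lt_or_gt_of_ne hij' with h | h
  · have e1 : i = ⟨0, by omega⟩ := Fin.ext (by simp only; omega)
    have e2 : j = ⟨1, by omega⟩ := Fin.ext (by simp only; omega)
    rw [e1, e2]
    exact h01
  · have e1 : i = ⟨1, by omega⟩ := Fin.ext (by simp only; omega)
    have e2 : j = ⟨0, by omega⟩ := Fin.ext (by simp only; omega)
    rw [e1, e2]
    exact h01.symm

/-- The comparison for a clique `C` with extreme positions `p` and `q`, through a window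
between them on which the partial sums at the ends are at least those at `p` and `q`. -/
theorem eq_kiteGraph_of_window (hl : 1 ≤ l) (hc : 1 ≤ c) (hμ : IsKiteValue c l μ)
    (hG : G.Connected) (hf : Antitone f) (hne : f ≠ 0) (hs : ∑ u, f u = 0)
    (hL : ∀ u, G.laplacian f u = α * f u) (hα : 0 < α) (hαμ : α ≤ μ)
    {C : Finset (Fin (c + 2 + l))} (hC : G.IsNClique (c + 2) C) {p q : Fin (c + 2 + l)}
    (hp : p ∈ C) (hq : q ∈ C) (hpC : ∀ i ∈ C, p ≤ i) (hqC : ∀ i ∈ C, i ≤ q)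
    {a b : ℕ} (hab : a + b = l) (hpa : (p : ℕ) ≤ a) (haq : a + c + 1 ≤ (q : ℕ))
    (hwin : partialSum f (p + 1) + partialSum f q
      ≤ partialSum f (a + 1) + partialSum f (a + c + 1))
    (hside : pathSeq μ a ≤ (1 - μ / (c + 2)) * pathSeq μ (a + 1)) :
    G = kiteGraph (c + 2 + l) (c + 2) := by
  have hspread := hC.isClique.mul_sub_le hf hL hp hq hpC hqC
  rw [hC.card_eq] at hspread
  push_cast at hspread
  have hc0 : (0 : ℝ) ≤ c := Nat.cast_nonneg c
  have hfa : f ⟨a, by omega⟩ ≤ f p := hf (by rw [Fin.le_def]; exact hpa)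
  have hfq : f q ≤ f ⟨a + c + 1, by omega⟩ := hf (by rw [Fin.le_def]; exact haq)
  have hmono := mul_le_mul_of_nonneg_left hwin hα.le
  have hshort := mul_le_mul_of_nonneg_left
    (sub_le_sub hfa hfq) (by linarith : (0 : ℝ) ≤ c + 2)
  obtain ⟨rfl, h1, h2, h3, h4⟩ := rigidity_of_window rfl hμ hG hf hne hs hL hαμ hab
    (fun h => by omega) hside (by linarith)
  simp only [zero_add] at h3 h4 hfa hfq hshort hmono
  have hcut := eq_of_adj_across_of_rigid hf hne hs hL hα h2 h3 h4 hl
  refine eq_kiteGraph hG ?_ hcut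
  have hp0 : p = ⟨0, by omega⟩ := Fin.ext (by simp only; omega)
  -- the clique cannot extend beyond the window, because the values drop strictly there
  have hqc : (q : ℕ) = c + 1 := by
    by_contra hne'
    have h5 := h2 (c + 1) le_rfl (by omega)
    have h6 : f q ≤ f ⟨c + 1 + 1, by omega⟩ := hf (by rw [Fin.le_def]; simp only; omega)
    have h7 := mul_pos hα (partialSum_pos hf hne hs (show 0 < c + 1 + 1 by omega) (by omega))
    have h8 : ((c : ℝ) + 2) * (f p - f q) ≤ (c + 2) * (f ⟨0, by omega⟩ - f ⟨c + 1, by omega⟩) := by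
      rw [h4]
      linarith
    have h9 := le_of_mul_le_mul_left h8 (by linarith)
    rw [hp0] at h9
    linarith
  have hmem : ∀ i : Fin (c + 2 + l), (i : ℕ) < c + 2 → i ∈ C := by
    have hsub : C ⊆ Finset.Iic q := fun i hi => Finset.mem_Iic.mpr (hqC i hi)
    have heq : C = Finset.Iic q := Finset.eq_of_subset_of_card_le hsub (by
      rw [Fin.card_Iic, hC.card_eq, hqc])
    intro i hi
    rw [heq, Finset.mem_Iic, Fin.le_def]
    omega
  exact fun i j hi hj hij => hC.isClique (hmem i hi) (hmem j hj) hij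

theorem laplacian_neg_rev {n : ℕ} (G : SimpleGraph (Fin n)) (f : Fin n → ℝ) (u : Fin n) :
    (G.comap Fin.rev).laplacian (fun i => -f i.rev) u = -G.laplacian f u.rev := by
  let φ : G.comap Fin.rev ≃g G := ⟨Fin.revPerm, Iff.rfl⟩
  have h1 : (G.comap Fin.rev).laplacian (fun i => -f i.rev) u
      = G.laplacian (fun i => -f i) u.rev := laplacian_comp_iso φ (fun i => -f i) u
  rw [h1, laplacian, laplacian, ← Finset.sum_neg_distrib]
  refine Finset.sum_congr rfl fun v _ => ?_
  split_ifs <;> ring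

theorem nonempty_iso_kiteGraph_of_le_of_pos (hl : 1 ≤ l) (hc : 1 ≤ c) (hμ : IsKiteValue c l μ)
    (hG : G.Connected) (hf : Antitone f) (hne : f ≠ 0) (hs : ∑ u, f u = 0)
    (hL : ∀ u, G.laplacian f u = α * f u) (hα : 0 < α) (hαμ : α ≤ μ)
    {C : Finset (Fin (c + 2 + l))} (hC : G.IsNClique (c + 2) C) :
    Nonempty (G ≃g kiteGraph (c + 2 + l) (c + 2)) := by
  have hCne : C.Nonempty := by
    rw [← Finset.card_pos, hC.card_eq]
    omega
  set p := C.min' hCne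
  set q := C.max' hCne
  have hp : p ∈ C := C.min'_mem hCne
  have hq : q ∈ C := C.max'_mem hCne
  have hpC : ∀ i ∈ C, p ≤ i := fun i hi => C.min'_le i hi
  have hqC : ∀ i ∈ C, i ≤ q := fun i hi => C.le_max' i hi
  have hpq : (p : ℕ) + c + 1 ≤ q := by
    have h1 : C ⊆ Finset.Icc p q := fun i hi => Finset.mem_Icc.mpr ⟨hpC i hi, hqC i hi⟩
    have h2 := Finset.card_le_card h1
    rw [hC.card_eq, Fin.card_Icc] at h2
    omega
  have hqn := q.2
  -- by unimodality of the partial sums one of the two extreme windows will do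
  obtain ⟨a, hpa, haq, hwin⟩ : ∃ a, (p : ℕ) ≤ a ∧ a + c + 1 ≤ (q : ℕ) ∧
      partialSum f (p + 1) + partialSum f q
        ≤ partialSum f (a + 1) + partialSum f (a + c + 1) := by
    rcases le_total (partialSum f q) (partialSum f (p + 1)) with h | h
    · refine ⟨p, le_rfl, hpq, ?_⟩
      have := min_le_partialSum hf (a := p + 1) (b := p + c + 1) (d := q) (by omega) hpq hqn.le
      rw [min_eq_right h] at this
      linarith
    · refine ⟨q - (c + 1), by omega, by omega, ?_⟩
      have := min_le_partialSum hf (a := p + 1) (b := q - (c + 1) + 1) (d := q) (by omega)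
        (by omega) hqn.le
      rw [min_eq_left h] at this
      rw [show (q : ℕ) - (c + 1) + c + 1 = q by omega]
      linarith
  have hal : a + (l - a) = l := by omega
  rcases hμ.exists_side hal with hside | hside
  · rw [← eq_kiteGraph_of_window hl hc hμ hG hf hne hs hL hα hαμ hC hp hq hpC hqC hal hpa haq
      hwin hside]
    exact ⟨Iso.refl⟩
  · -- reverse the order of the vertices
    let φ : G.comap Fin.rev ≃g G := ⟨Fin.revPerm, Iff.rfl⟩
    have hX : ∀ k ≤ c + 2 + l, partialSum (fun i => -f i.rev) k = partialSum f (c + 2 + l - k) :=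
      fun k hk => partialSum_neg_rev f hs hk
    have hmem : ∀ i, i ∈ C.map Fin.revPerm.toEmbedding ↔ i.rev ∈ C := by
      intro i
      rw [Finset.mem_map_equiv]
      rfl
    have h := eq_kiteGraph_of_window (G := G.comap Fin.rev) (f := fun i => -f i.rev)
      (C := C.map Fin.revPerm.toEmbedding) (p := q.rev) (q := p.rev) (a := l - a) (b := a)
      (α := α) hl hc hμ (φ.connected_iff.mpr hG)
      (fun i j hij => neg_le_neg (hf (Fin.rev_le_rev.mpr hij)))
      (fun h0 => hne (by
        ext i
        have := congrFun h0 i.rev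
        simpa using this))
      (by
        rw [Finset.sum_neg_distrib, neg_eq_zero, ← hs]
        exact Equiv.sum_comp Fin.revPerm f)
      (fun u => by rw [laplacian_neg_rev, hL]; ring) hα hαμ
      (by
        refine ⟨?_, by rw [Finset.card_map, hC.card_eq]⟩
        intro i hi j hj hij
        exact hC.isClique ((hmem i).mp hi) ((hmem j).mp hj) (fun h => hij (Fin.rev_injective h)))
      ((hmem _).mpr (by rwa [Fin.rev_rev])) ((hmem _).mpr (by rwa [Fin.rev_rev]))
      (fun i hi => Fin.rev_le_iff.mpr (hqC _ ((hmem i).mp hi)))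
      (fun i hi => Fin.le_rev_iff.mpr (hpC _ ((hmem i).mp hi)))
      (by omega) (by rw [Fin.val_rev]; omega) (by rw [Fin.val_rev]; omega)
      (by
        rw [Fin.val_rev, Fin.val_rev, hX _ (by omega), hX _ (by omega), hX _ (by omega),
          hX _ (by omega),
          show c + 2 + l - (c + 2 + l - ((q : ℕ) + 1) + 1) = q by omega,
          show c + 2 + l - (c + 2 + l - ((p : ℕ) + 1)) = p + 1 by omega,
          show c + 2 + l - (l - a + 1) = a + c + 1 by omega,
          show c + 2 + l - (l - a + c + 1) = a + 1 by omega]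
        linarith)
      hside
    rw [← h]
    exact ⟨φ.symm⟩

end Ordered

theorem exists_equiv_antitone {V : Type*} [Fintype V] {n : ℕ} (hn : Fintype.card V = n)
    (f : V → ℝ) : ∃ e : Fin n ≃ V, Antitone fun i => f (e i) := by
  let e₀ : Fin n ≃ V := (Fintype.equivFinOfCardEq hn).symm
  refine ⟨(Tuple.sort fun i => -f (e₀ i)).trans e₀, fun i j hij => ?_⟩
  have := Tuple.monotone_sort (fun i => -f (e₀ i)) hij
  simpa using this

/-- A connected graph with a clique of order `c + 2` whose algebraic connectivity does not
exceed that of the kite is the kite. -/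
theorem nonempty_iso_kiteGraph_of_le {V : Type*} [Fintype V] {c l : ℕ} (hl : 1 ≤ l)
    (G : SimpleGraph V) (hV : Fintype.card V = c + 2 + l) (hG : G.Connected) {C : Finset V}
    (hC : G.IsNClique (c + 2) C)
    (hle : G.algebraicConnectivity ≤ (kiteGraph (c + 2 + l) (c + 2)).algebraicConnectivity) :
    Nonempty (G ≃g kiteGraph (c + 2 + l) (c + 2)) := by
  have hV2 : 2 ≤ Fintype.card V := by omega
  have hα := G.algebraicConnectivity_pos hG hV2
  obtain ⟨f, hf, hs, hL⟩ := G.exists_fiedler hG hV2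
  obtain ⟨e, he⟩ := exists_equiv_antitone hV f
  have hμ := kiteGraph_isKiteValue (c := c) hl
  let φ : G.comap e ≃g G := ⟨e, Iff.rfl⟩
  have hG' : (G.comap e).Connected := φ.connected_iff.mpr hG
  have hf' : (fun i => f (e i)) ≠ 0 := fun h0 => hf (by
    ext v
    have := congrFun h0 (e.symm v)
    simpa using this)
  have hs' : ∑ i, f (e i) = 0 := by rw [Equiv.sum_comp e f, hs]
  have hL' : ∀ u, (G.comap e).laplacian (fun i => f (e i)) u
      = G.algebraicConnectivity * f (e u) := fun u => by
    have h := laplacian_comp_iso φ f u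
    exact h.trans (hL _)
  suffices h : Nonempty (G.comap e ≃g kiteGraph (c + 2 + l) (c + 2)) from
    h.map fun ψ => φ.symm.trans ψ
  rcases Nat.eq_zero_or_pos c with rfl | hc
  · rw [← eq_kiteGraph_of_le_of_zero hl hμ hG' he hf' hs' hL' hle]
    exact ⟨Iso.refl⟩
  · refine nonempty_iso_kiteGraph_of_le_of_pos hl hc hμ hG' he hf' hs' hL' hα hle
      (C := C.map e.symm.toEmbedding) ⟨?_, by rw [Finset.card_map, hC.card_eq]⟩
    have hmem : ∀ i, i ∈ C.map e.symm.toEmbedding ↔ e i ∈ C := by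
      intro i
      rw [Finset.mem_map_equiv]
      rfl
    intro i hi j hj hij
    exact hC.isClique ((hmem i).mp hi) ((hmem j).mp hj) (fun h => hij (e.injective h))

theorem nonempty_iso_kiteGraph_self {V : Type*} [Fintype V] {n : ℕ} (G : SimpleGraph V)
    (hV : Fintype.card V = n) {C : Finset V} (hC : G.IsNClique n C) :
    Nonempty (G ≃g kiteGraph n n) := by
  have hCu : C = Finset.univ := by
    rw [← Finset.card_eq_iff_eq_univ, hC.card_eq, hV]
  refine ⟨⟨Fintype.equivFinOfCardEq hV, fun {u v} => ?_⟩⟩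
  rw [kiteGraph_adj]
  constructor
  · rintro ⟨h, -⟩
    exact hC.isClique (by simp [hCu]) (by simp [hCu]) fun h' => h (by rw [h'])
  · intro h
    exact ⟨fun h' => h.ne (Equiv.injective _ h'), Or.inl ⟨Fin.is_lt _, Fin.is_lt _⟩⟩

end SimpleGraph

theorem theorem1p6 {V : Type*} [Fintype V] (n r : ℕ) (G : SimpleGraph V)
    (hn : Fintype.card V = n) (hG : G.Connected) (hr : 2 ≤ r) (hcl : G.cliqueNum = r) :
    (kiteGraph n r).algebraicConnectivity ≤ G.algebraicConnectivity ∧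
      (G.algebraicConnectivity = (kiteGraph n r).algebraicConnectivity ↔
        Nonempty (G ≃g kiteGraph n r)) := by
  obtain ⟨C, hC⟩ := G.exists_isNClique_cliqueNum
  rw [hcl] at hC
  have hrn : r ≤ n := by
    rw [← hC.card_eq, ← hn]
    exact Finset.card_le_univ C
  have hV2 : 2 ≤ Fintype.card V := by omega
  have key : G.algebraicConnectivity ≤ (kiteGraph n r).algebraicConnectivity →
      Nonempty (G ≃g kiteGraph n r) := by
    intro hle
    obtain ⟨c, rfl⟩ : ∃ c, r = c + 2 := ⟨r - 2, by omega⟩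
    obtain ⟨l, rfl⟩ : ∃ l, n = c + 2 + l := ⟨n - (c + 2), by omega⟩
    rcases Nat.eq_zero_or_pos l with rfl | hl
    · exact G.nonempty_iso_kiteGraph_self hn hC
    · exact SimpleGraph.nonempty_iso_kiteGraph_of_le hl G hn hG hC hle
  have hcongr : Nonempty (G ≃g kiteGraph n r) →
      G.algebraicConnectivity = (kiteGraph n r).algebraicConnectivity :=
    fun ⟨φ⟩ => SimpleGraph.algebraicConnectivity_congr φ hG hV2
  refine ⟨?_, fun h => key h.le, hcongr⟩
  rcases le_total (kiteGraph n r).algebraicConnectivity G.algebraicConnectivity with h | h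
  · exact h
  · exact (hcongr (key h)).ge
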